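/- Let $p$ be an odd prime. For $n\ge 0$ let $X$ be a random symmetric $n\times n$ matrix over $\mathbb{Z}_p$ whose entries $x_{ij}$, $i\le j$, are independent and distributed according to the Haar probability measure on $\mathbb{Z}_p$. If $X$ is non-singular, write $X=U\,\mathrm{diag}(p^{k_1},\dots,p^{k_n})\,V$ with $U,V\in\mathrm{GL}_n(\mathbb{Z}_p)$ and integers $k_i\ge 0$, which are unique up to order (the exponents of the elementary divisors of $X$). For a partition $\lambda=(\lambda_1\ge\lambda_2\ge\dots\ge\lambda_l>0)$, $l \ge 0$, of any size, let $m_i(\lambda)=\#\{j:\lambda_j=i\}$ and let $f_n(\lambda)$ be the probability that $X$ is non-singular and the positive ones among $k_1,\dots,k_n$, with multiplicity and in non-increasing order, are $\lambda_1,\dots,\lambda_l$. Put $$\pi_\infty=\prod_{i=1}^\infty(1-p^{-i}),\qquad \beta_\infty=\prod_{i=1}^\infty(1-p^{-2i}),\qquad d_\lambda(t)=\prod_{i\ge1}\ \prod_{j=1}^{\lfloor m_i(\lambda)/2\rfloor}(1-t^{2j}).$$ Then for every partition $\lambda$ the limit of $f_n(\lambda)$ as $n\to\infty$ exists and $$\lim_{n\to\infty}f_n(\lambda)=f(\lambda):=\frac{\pi_\infty}{\beta_\infty\,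 d_\lambda(p^{-1})}\;p^{-\sum_{i=1}^{l} i\lambda_i}.$$ Moreover $f$ is a probability distribution on the set of all partitions: $f(\lambda)\ge 0$ for all $\lambda$ and $\sum_\lambda f(\lambda)=1$. -/

import Mathlib

open MeasureTheory Filter Topology

namespace SymPadic

noncomputable section

/-- The Borel σ-algebra on the ring of `p`-adic integers. -/
instance instMeasurableSpacePadicInt (p : ℕ) [Fact p.Prime] : MeasurableSpace ℤ_[p] :=
  borel ℤ_[p]

instance instBorelSpacePadicInt (p : ℕ) [Fact p.Prime] : BorelSpace ℤ_[p] := ⟨rfl⟩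

/-- The Haar measure on the additive group `ℤ_[p]`, normalised to have total mass `1`. -/
def haar (p : ℕ) [Fact p.Prime] : Measure ℤ_[p] :=
  Measure.addHaarMeasure (⊤ : TopologicalSpace.PositiveCompacts ℤ_[p])

instance instIsProbabilityMeasureHaar (p : ℕ) [Fact p.Prime] :
    IsProbabilityMeasure (haar p) :=
  ⟨by simpa [haar] using
    Measure.addHaarMeasure_self (K₀ := (⊤ : TopologicalSpace.PositiveCompacts ℤ_[p]))⟩

/-- The positions on or above the diagonal of an `n × n` matrix. -/
abbrev UpperIdx (n : ℕ) : Type := {ij : Fin n × Fin n // ij.1 ≤ ij.2}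

/-- The symmetric matrix with prescribed entries on and above the diagonal. -/
def symMatrix {R : Type*} {n : ℕ} (x : UpperIdx n → R) : Matrix (Fin n) (Fin n) R :=
  Matrix.of fun i j => x ⟨(min i j, max i j), min_le_max⟩

theorem symMatrix_isSymm {R : Type*} {n : ℕ} (x : UpperIdx n → R) : (symMatrix x).IsSymm := by
  ext i j
  simp [symMatrix, min_comm, max_comm]

/-- The law of the entries `x i j`, `i ≤ j`, of a random symmetric `n × n` matrix over `ℤ_[p]`:
they are independent and Haar distributed. -/
def entryLaw (p : ℕ) [Fact p.Prime] (n : ℕ) : Measure (UpperIdx n → ℤ_[p]) :=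
  Measure.pi fun _ => haar p

/-- `X ∈ K Σ K` for `K = GL n ℤ_[p]` and `Σ = diag (p ^ k₁, …, p ^ kₙ)`: the matrix `X` is
non-singular and, up to their order, `k₁, …, kₙ` are the exponents of its elementary divisors. -/
def HasElementaryDivisors {p : ℕ} [Fact p.Prime] {n : ℕ}
    (X : Matrix (Fin n) (Fin n) ℤ_[p]) (k : Fin n → ℕ) : Prop :=
  ∃ U V : GL (Fin n) ℤ_[p],
    X = (U : Matrix (Fin n) (Fin n) ℤ_[p]) *
      Matrix.diagonal (fun i => (p : ℤ_[p]) ^ k i) * (V : Matrix (Fin n) (Fin n) ℤ_[p])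

/-- Integer partitions (of arbitrary size). -/
abbrev IntPartition : Type := Σ m : ℕ, Nat.Partition m

/-- The positive exponents among those of the elementary divisors of `X`, with multiplicity, are
the parts of the partition `lam`. -/
def HasType {p : ℕ} [Fact p.Prime] {n : ℕ}
    (X : Matrix (Fin n) (Fin n) ℤ_[p]) (lam : IntPartition) : Prop :=
  ∃ k : Fin n → ℕ, HasElementaryDivisors X k ∧
    ((Finset.univ : Finset (Fin n)).val.map k).filter (fun a => 0 < a) = lam.2.parts

/-- `f_n(λ)`: the probability that a random symmetric `n × n` matrix over `ℤ_[p]` is non-singular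
and that the positive exponents of its elementary divisors form the partition `λ`. -/
def fn (p : ℕ) [Fact p.Prime] (n : ℕ) (lam : IntPartition) : ℝ :=
  (entryLaw p n).real {x | HasType (symMatrix x) lam}

/-- `π_∞ = ∏_{i ≥ 1} (1 - p ^ (-i))`. -/
def piInf (p : ℕ) : ℝ := ∏' i : ℕ, (1 - ((p : ℝ)⁻¹) ^ (i + 1))

/-- `β_∞ = ∏_{i ≥ 1} (1 - p ^ (-2 i))`. -/
def betaInf (p : ℕ) : ℝ := ∏' i : ℕ, (1 - ((p : ℝ)⁻¹) ^ (2 * (i + 1)))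

/-- Both infinite products above converge. -/
theorem multipliable_one_sub_pow {t : ℝ} (h0 : 0 ≤ t) (h1 : t < 1) :
    Multipliable (fun i : ℕ => 1 - t ^ (i + 1)) ∧
      Multipliable (fun i : ℕ => 1 - t ^ (2 * (i + 1))) := by
  have hs : ∀ s : ℝ, 0 ≤ s → s < 1 → Multipliable (fun i : ℕ => 1 - s ^ (i + 1)) := by
    intro s hs0 hs1
    have := Real.multipliable_one_add_of_summable (f := fun i : ℕ => -(s ^ (i + 1)))
      (((summable_nat_add_iff 1).2 (summable_geometric_of_lt_one hs0 hs1)).neg)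
    simpa [sub_eq_add_neg] using this
  refine ⟨hs t h0 h1, ?_⟩
  simpa [pow_mul] using hs (t ^ 2) (by positivity) (pow_lt_one₀ h0 h1 two_ne_zero)

/-- `d_λ(t) = ∏_{i ≥ 1} ∏_{j = 1}^{⌊m_i / 2⌋} (1 - t ^ (2 j))`, where `m_i` is the number of parts
of `λ` equal to `i` (values `i` with `m_i = 0` contribute the factor `1`). -/
def dPoly (lam : IntPartition) (t : ℝ) : ℝ :=
  ∏ i ∈ lam.2.parts.toFinset, ∏ j ∈ Finset.Icc 1 (lam.2.parts.count i / 2), (1 - t ^ (2 * j))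

/-- The parts `λ₁ ≥ λ₂ ≥ ⋯ ≥ λ_l` of `λ` in non-increasing order. -/
def partList (lam : IntPartition) : List ℕ := lam.2.parts.sort (· ≥ ·)

/-- `∑_i i λ_i`, where `λ₁ ≥ λ₂ ≥ ⋯` are the parts of `λ`. -/
def weightedSum (lam : IntPartition) : ℕ :=
  ∑ i : Fin (partList lam).length, ((i : ℕ) + 1) * (partList lam).get i

/-- `f(λ) = π_∞ / (β_∞ d_λ(p⁻¹)) · p ^ (-∑ i λ_i)`. -/
def fLim (p : ℕ) (lam : IntPartition) : ℝ :=
  piInf p / (betaInf p * dPoly lam (p : ℝ)⁻¹) * ((p : ℝ)⁻¹) ^ weightedSum lam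

end

end SymPadic

/-! Write `t = 1/p` and condition on the reduction `M` of `X` modulo `p`. If `M` has corank `r`, a
congruence over `ℤ_p` gives `X` an invertible leading block of size `n - r`, and the Schur
complement of that block is `pY` with `Y` symmetric of size `r`. The type of `X` is that of `Y` with
all `r` exponents, zeros included, raised by one. Translating `X` by suitable matrices divisible by
`p` translates `Y` arbitrarily, so the conditional law of `Y` is translation invariant, hence Haar
(`entryLaw_redEntries_inter`). With `s` the parts of `λ` and `r` their number, this gives `P_n(s) =
corankProb n r * P_r(predParts s)` (`entryLaw_hasParts`).

The corank of a uniform symmetric matrix over a finite field is a Markov chain in `n`: bordering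
changes it by at most one, with explicit probabilities. Solving the recurrence gives
`corankProb_eq`. Substituting it into the recursion for `P_n`, the factors `qPoch t r` telescope,
the triangular exponents add up to `∑ i λ_i` and the remaining factors form `d_λ`. The result is the
exact formula `fn_eq`: `f_n(λ) = qPoch t n / evenPoch t ((n - l) / 2) * t ^ (∑ i λ_i) / d_λ(t)`,
from which the limit is immediate.

The same conditioning shows that matrices without a type form a null set, so each `f_n` has total
mass one. The quotients of products are bounded uniformly in `n`, and dominated convergence carries
the total mass to the limit. -/

namespace SymPadic

/-! ### Corank of a bordered symmetric matrix over a field. -/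

section Field

variable {F : Type*} [Field F]

/-- The dimension of the kernel of a matrix. -/
noncomputable def corank {m n : Type*} [Fintype n] (M : Matrix m n F) : ℕ :=
  Module.finrank F (LinearMap.ker M.mulVecLin)

theorem rank_add_corank {m n : Type*} [Fintype m] [Fintype n] (M : Matrix m n F) :
    M.rank + corank M = Fintype.card n := by
  rw [corank, Matrix.rank, LinearMap.finrank_range_add_finrank_ker, Module.finrank_fintype_fun_eq_card]

theorem finrank_ker_congr {V V' W W' : Type*} [AddCommGroup V] [AddCommGroup V'] [AddCommGroup W]
    [AddCommGroup W'] [Module F V] [Module F V'] [Module F W] [Module F W']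
    (e : V ≃ₗ[F] V') (e' : W ≃ₗ[F] W') (f : V →ₗ[F] W) (g : V' →ₗ[F] W')
    (h : ∀ x, g (e x) = e' (f x)) :
    Module.finrank F (LinearMap.ker f) = Module.finrank F (LinearMap.ker g) := by
  have : LinearMap.ker g = (LinearMap.ker f).map (e : V →ₗ[F] V') := by
    ext y
    constructor
    · intro hy
      refine ⟨e.symm y, ?_, by simp⟩
      have := h (e.symm y)
      simp only [LinearEquiv.apply_symm_apply, LinearMap.mem_ker.1 hy] at this
      exact (LinearEquiv.map_eq_zero_iff e').1 this.symm
    · rintro ⟨x, hx, rfl⟩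
      have hx' : f x = 0 := hx
      simp [LinearMap.mem_ker, h, hx']
  rw [this, LinearEquiv.finrank_map_eq]

/-- The symmetric matrix `[[a, vᵀ], [v, X]]`. -/
def border {R : Type*} {n : ℕ} (X : Matrix (Fin n) (Fin n) R) (v : Fin n → R) (a : R) :
    Matrix (Fin (n + 1)) (Fin (n + 1)) R :=
  Matrix.of (Fin.cons (Fin.cons a v) fun i => Fin.cons (v i) (X i))

/-- The linear map of `border X v a`, in terms of the splitting `F × Fⁿ`. -/
def borderMap {n : ℕ} (X : Matrix (Fin n) (Fin n) F) (v : Fin n → F) (a : F) :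
    F × (Fin n → F) →ₗ[F] F × (Fin n → F) where
  toFun x := (a * x.1 + v ⬝ᵥ x.2, x.1 • v + X.mulVec x.2)
  map_add' x y := by
    simp only [Prod.fst_add, Prod.snd_add, dotProduct_add, Matrix.mulVec_add, add_smul,
      Prod.mk_add_mk, Prod.mk.injEq]
    exact ⟨by ring, by abel⟩
  map_smul' c x := by
    simp only [Prod.smul_fst, Prod.smul_snd, dotProduct_smul, Matrix.mulVec_smul, smul_eq_mul,
      RingHom.id_apply, Prod.smul_mk, mul_smul, smul_add, Prod.mk.injEq, and_true]
    ring

theorem corank_border {n : ℕ} (X : Matrix (Fin n) (Fin n) F) (v : Fin n → F) (a : F) :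
    corank (border X v a) = Module.finrank F (LinearMap.ker (borderMap X v a)) := by
  refine (finrank_ker_congr (Fin.consLinearEquiv F fun _ => F) (Fin.consLinearEquiv F fun _ => F)
    _ _ ?_).symm
  rintro ⟨c, u⟩
  ext i
  refine Fin.cases ?_ (fun i => ?_) i
  · simp [border, borderMap, Matrix.mulVec, dotProduct, Fin.sum_univ_succ]
  · simp [border, borderMap, Matrix.mulVec, dotProduct, Fin.sum_univ_succ, mul_comm]

/-- The annihilator of the kernel is the range of the dual map, and symmetry identifies the dual map
with `X` itself. -/
theorem mem_range_mulVecLin_of_forall_ker {n : ℕ} {X : Matrix (Fin n) (Fin n) F} (hX : X.IsSymm)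
    {v : Fin n → F} (h : ∀ u, X.mulVec u = 0 → v ⬝ᵥ u = 0) :
    v ∈ LinearMap.range X.mulVecLin := by
  let φ : Module.Dual F (Fin n → F) := dotProductEquiv F (Fin n) v
  have hφ : φ ∈ (LinearMap.ker X.mulVecLin).dualAnnihilator := by
    rw [Submodule.mem_dualAnnihilator]
    intro u hu
    simpa [φ] using h u (by simpa using hu)
  rw [← LinearMap.range_dualMap_eq_dualAnnihilator_ker] at hφ
  obtain ⟨g, hg⟩ := hφ
  obtain ⟨w, rfl⟩ := (dotProductEquiv F (Fin n)).surjective g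
  refine ⟨w, ?_⟩
  refine (dotProductEquiv F (Fin n)).injective (LinearMap.ext fun u => ?_)
  have := LinearMap.congr_fun hg u
  simp only [LinearMap.dualMap_apply, dotProductEquiv_apply_apply, Matrix.mulVecLin_apply, φ]
    at this ⊢
  rw [← this, Matrix.dotProduct_mulVec, ← Matrix.mulVec_transpose, hX.eq]

/-- A kernel vector `(c, u)` must have `c = 0`, since otherwise `v` would lie in the range. What
remains is the kernel of the functional `v ⬝ᵥ ·` on `ker X`, which is nonzero by the duality above.
-/
theorem corank_border_of_notMem {n : ℕ} {X : Matrix (Fin n) (Fin n) F} (hX : X.IsSymm)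
    {v : Fin n → F} (hv : v ∉ LinearMap.range X.mulVecLin) (a : F) :
    corank (border X v a) + 1 = corank X := by
  let φ : Module.Dual F (LinearMap.ker X.mulVecLin) :=
    (dotProductEquiv F (Fin n) v).domRestrict _
  have hφ : φ ≠ 0 := by
    intro h0
    refine hv (mem_range_mulVecLin_of_forall_ker hX fun u hu => ?_)
    simpa [φ] using LinearMap.congr_fun h0 ⟨u, by simpa using hu⟩
  rw [corank_border, corank, ← Module.Dual.finrank_ker_add_one_of_ne_zero hφ]
  congr 1
  have : LinearMap.ker (borderMap X v a) = (LinearMap.ker φ).map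
      (LinearMap.inr F F (Fin n → F) ∘ₗ (LinearMap.ker X.mulVecLin).subtype) := by
    ext ⟨c, u⟩
    simp only [LinearMap.mem_ker, Submodule.mem_map, LinearMap.comp_apply, LinearMap.inr_apply,
      Submodule.subtype_apply, Prod.mk.injEq]
    constructor
    · intro h
      simp only [borderMap, LinearMap.coe_mk, AddHom.coe_mk, Prod.mk_eq_zero] at h
      obtain ⟨h1, h2⟩ := h
      have hc : c = 0 := by
        by_contra hc
        refine hv ⟨-(c⁻¹ • u), ?_⟩
        have : X.mulVec u = -(c • v) := by rw [eq_neg_iff_add_eq_zero, add_comm, h2]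
        simp [Matrix.mulVec_neg, Matrix.mulVec_smul, this, smul_smul, inv_mul_cancel₀ hc]
      subst hc
      refine ⟨⟨u, by simpa using h2⟩, by simpa [φ] using h1, rfl, rfl⟩
    · rintro ⟨⟨u', hu'⟩, h1, rfl, rfl⟩
      have hu2 : X.mulVec u' = 0 := by simpa using hu'
      have h1' : v ⬝ᵥ u' = 0 := by simpa [φ] using h1
      simp [borderMap, hu2, h1']
  rw [this]
  exact (Submodule.equivMapOfInjective _ (by
    rw [LinearMap.coe_comp]
    exact LinearMap.inr_injective.comp Subtype.val_injective) _).finrank_eq.symm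

/-- Clearing the first row and column with `w` turns the bordered matrix into the direct sum of the
scalar `δ = a - wᵀXw` and `X`; the scalar adds to the kernel only when it is zero. -/
theorem corank_border_mulVec {n : ℕ} {X : Matrix (Fin n) (Fin n) F} (hX : X.IsSymm)
    (w : Fin n → F) (a : F) [Decidable (a = X.mulVec w ⬝ᵥ w)] :
    corank (border X (X.mulVec w) a) = (if a = X.mulVec w ⬝ᵥ w then 1 else 0) + corank X := by
  set δ := a - X.mulVec w ⬝ᵥ w with hδ
  -- `e` is the column operation and `e'` the inverse of the matching row operation: `borderMap ∘ e
  -- = e' ∘ (δ ⊕ X)`.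
  let e : (F × (Fin n → F)) ≃ₗ[F] F × (Fin n → F) :=
    { toFun := fun x => (x.1, x.2 - x.1 • w)
      invFun := fun x => (x.1, x.2 + x.1 • w)
      map_add' := fun x y => by ext <;> simp [add_smul]; ring
      map_smul' := fun c x => by ext <;> simp [mul_smul]; ring
      left_inv := fun x => by simp
      right_inv := fun x => by simp }
  let e' : (F × (Fin n → F)) ≃ₗ[F] F × (Fin n → F) :=
    { toFun := fun x => (x.1 + w ⬝ᵥ x.2, x.2)
      invFun := fun x => (x.1 - w ⬝ᵥ x.2, x.2)
      map_add' := fun x y => by ext <;> simp; ring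
      map_smul' := fun c x => by ext <;> simp; ring
      left_inv := fun x => by simp
      right_inv := fun x => by simp }
  rw [corank_border, ← finrank_ker_congr e e'
    ((LinearMap.lsmul F F δ).prodMap X.mulVecLin) (borderMap X (X.mulVec w) a)]
  · let s : ((LinearMap.ker (LinearMap.lsmul F F δ)).prod (LinearMap.ker X.mulVecLin)) ≃ₗ[F]
        LinearMap.ker (LinearMap.lsmul F F δ) × LinearMap.ker X.mulVecLin :=
      { toFun := fun x => (⟨x.1.1, x.2.1⟩, ⟨x.1.2, x.2.2⟩)
        invFun := fun x => ⟨(x.1.1, x.2.1), x.1.2, x.2.2⟩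
        map_add' := fun _ _ => rfl
        map_smul' := fun _ _ => rfl
        left_inv := fun _ => rfl
        right_inv := fun _ => rfl }
    rw [LinearMap.ker_prodMap, s.finrank_eq, Module.finrank_prod, corank]
    congr 1
    by_cases h : δ = 0
    · rw [if_pos (sub_eq_zero.1 (hδ ▸ h)), h, map_zero, LinearMap.ker_zero, finrank_top,
        Module.finrank_self]
    · rw [if_neg fun h' => h (hδ ▸ sub_eq_zero.2 h'), LinearMap.ker_eq_bot.2, finrank_bot]
      intro x y hxy
      simpa [h] using hxy
  · rintro ⟨c, u⟩
    have : X.mulVec w ⬝ᵥ u = w ⬝ᵥ X.mulVec u := by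
      rw [Matrix.dotProduct_mulVec, ← Matrix.mulVec_transpose, hX.eq]
    simp only [borderMap, LinearMap.coe_mk, AddHom.coe_mk, LinearEquiv.coe_mk, e, e', hδ,
      LinearMap.prodMap_apply, LinearMap.lsmul_apply, Matrix.mulVecLin_apply, dotProduct_sub,
      dotProduct_smul, smul_eq_mul, Matrix.mulVec_sub, Matrix.mulVec_smul, this, Prod.mk.injEq]
    exact ⟨by ring, by abel⟩

end Field

/-! ### Symmetric matrices as tuples of upper entries, and splitting off the first row. -/

section Upper

variable {R : Type*} {n : ℕ}

/-- The entries of a matrix on and above the diagonal. -/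
def upper (M : Matrix (Fin n) (Fin n) R) : UpperIdx n → R := fun ij => M ij.1.1 ij.1.2

theorem upper_symMatrix (x : UpperIdx n → R) : upper (symMatrix x) = x := by
  ext ⟨⟨i, j⟩, h⟩
  have h' : i ≤ j := h
  simp [upper, symMatrix, h']

theorem symMatrix_upper {M : Matrix (Fin n) (Fin n) R} (hM : M.IsSymm) :
    symMatrix (upper M) = M := by
  ext i j
  rcases le_total i j with h | h
  · simp [upper, symMatrix, h]
  · simpa [upper, symMatrix, h] using hM.apply i j

theorem border_isSymm {X : Matrix (Fin n) (Fin n) R} (hX : X.IsSymm) (v : Fin n → R) (a : R) :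
    (border X v a).IsSymm := by
  ext i j
  refine Fin.cases ?_ (fun i => ?_) i <;> refine Fin.cases ?_ (fun j => ?_) j <;>
    simp [border, hX.apply]

/-- Splitting off the first row of a symmetric matrix. -/
def borderEquiv (R : Type*) (n : ℕ) :
    ((UpperIdx n → R) × (Fin n → R) × R) ≃ (UpperIdx (n + 1) → R) where
  toFun x := upper (border (symMatrix x.1) x.2.1 x.2.2)
  invFun y := (upper ((symMatrix y).submatrix Fin.succ Fin.succ),
    fun i => symMatrix y 0 i.succ, symMatrix y 0 0)
  left_inv x := by
    simp only [symMatrix_upper (border_isSymm (symMatrix_isSymm x.1) x.2.1 x.2.2)]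
    refine Prod.ext ?_ (Prod.ext rfl rfl)
    exact upper_symMatrix x.1
  right_inv y := by
    have : border (symMatrix (upper ((symMatrix y).submatrix Fin.succ Fin.succ)))
        (fun i => symMatrix y 0 i.succ) (symMatrix y 0 0) = symMatrix y := by
      rw [symMatrix_upper ((symMatrix_isSymm y).submatrix _)]
      ext i j
      refine Fin.cases ?_ (fun i => ?_) i <;> refine Fin.cases ?_ (fun j => ?_) j
      · simp [border]
      · simp [border]
      · simpa [border] using (symMatrix_isSymm y).apply i.succ 0
      · simp [border]
    simp only [this, upper_symMatrix]

theorem symMatrix_borderEquiv (x : UpperIdx n → R) (v : Fin n → R) (a : R) :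
    symMatrix (borderEquiv R n (x, v, a)) = border (symMatrix x) v a :=
  symMatrix_upper (border_isSymm (symMatrix_isSymm _) _ _)

end Upper

/-! ### Distribution of the corank over a finite field. -/

section Count

variable {F : Type*} [Field F] {n : ℕ}

theorem corank_le {m n : Type*} [Fintype m] [Fintype n] (M : Matrix m n F) :
    corank M ≤ Fintype.card n := by
  have := rank_add_corank M
  omega

variable [Fintype F]

-- Of the `q ^ n` vectors `v`, a proportion `q⁻¹ ^ r` lies in the range of `X`, where `r` is its
-- corank. Outside it the corank drops for every `a`; inside it exactly one `a` raises the corank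
-- and the others keep it. The truncated `r - 1` at `r = 0` is harmless because its weight vanishes.
open Classical in
theorem sum_corank_border {X : Matrix (Fin n) (Fin n) F} (hX : X.IsSymm) (g : ℕ → ℝ) :
    ∑ v : Fin n → F, ∑ a : F, g (corank (border X v a)) =
      (Fintype.card F : ℝ) ^ (n + 1) *
        ((1 - (Fintype.card F : ℝ)⁻¹ ^ corank X) * g (corank X - 1) +
          (Fintype.card F : ℝ)⁻¹ ^ corank X * (1 - (Fintype.card F : ℝ)⁻¹) * g (corank X) +
          (Fintype.card F : ℝ)⁻¹ ^ (corank X + 1) * g (corank X + 1)) := by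
  set q : ℝ := (Fintype.card F : ℝ) with hq
  have hq0 : q ≠ 0 := by simp [hq]
  set r := corank X with hr
  have h1 : ∀ v : Fin n → F, ∑ a : F, g (corank (border X v a)) =
      if v ∈ LinearMap.range X.mulVecLin then (q - 1) * g r + g (r + 1) else q * g (r - 1) := by
    intro v
    split_ifs with hv
    · obtain ⟨w, rfl⟩ := hv
      have : ∀ a : F, g (corank (border X (X.mulVecLin w) a)) =
          g r + if a = X.mulVec w ⬝ᵥ w then g (r + 1) - g r else 0 := by
        intro a
        rw [Matrix.mulVecLin_apply, corank_border_mulVec hX]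
        split_ifs
        · rw [add_comm 1]; ring
        · simp [hr]
      simp only [this, Finset.sum_add_distrib, Finset.sum_const, Finset.sum_ite_eq',
        Finset.mem_univ, if_true, Finset.card_univ, nsmul_eq_mul]
      ring
    · have : ∀ a : F, g (corank (border X v a)) = g (r - 1) := by
        intro a
        have := corank_border_of_notMem hX hv a
        rw [hr, ← this, Nat.add_sub_cancel]
      simp only [this, Finset.sum_const, Finset.card_univ, nsmul_eq_mul, hq]
  simp only [h1, Finset.sum_ite, Finset.sum_const, nsmul_eq_mul]
  have hr' : X.rank + r = n := by simpa using rank_add_corank X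
  have hin : ((Finset.univ.filter fun v : Fin n → F => v ∈ LinearMap.range X.mulVecLin).card : ℝ) =
      q ^ n * q⁻¹ ^ r := by
    have : (Finset.univ.filter fun v : Fin n → F => v ∈ LinearMap.range X.mulVecLin).card =
        Fintype.card F ^ X.rank := by
      rw [← Fintype.card_subtype, Matrix.rank, ← Module.card_eq_pow_finrank]
    have hqn : q ^ n = q ^ X.rank * q ^ r := by rw [← pow_add, hr']
    rw [this, hqn, mul_assoc, ← mul_pow, mul_inv_cancel₀ hq0]
    simp [hq]
  have hall : ((Finset.univ.filter fun v : Fin n → F =>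
      v ∈ LinearMap.range X.mulVecLin).card : ℝ) +
      (Finset.univ.filter fun v : Fin n → F => v ∉ LinearMap.range X.mulVecLin).card = q ^ n := by
    rw [← Nat.cast_add, Finset.card_filter_add_card_filter_not]
    simp [hq]
  rw [← eq_sub_iff_add_eq'] at hall
  rw [hall, hin, pow_succ q⁻¹]
  field_simp
  ring

open Classical in
/-- The probability that a uniformly random symmetric `n × n` matrix over `F` has corank `r`. -/
noncomputable def corankProb (F : Type*) [Field F] [Fintype F] (n r : ℕ) : ℝ :=
  (Fintype.card (UpperIdx n → F) : ℝ)⁻¹ *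
    ∑ x : UpperIdx n → F, if corank (symMatrix x) = r then 1 else 0

theorem corankProb_eq_zero {n r : ℕ} (h : n < r) : corankProb F n r = 0 := by
  rw [corankProb, Finset.sum_eq_zero, mul_zero]
  intro x _
  have := corank_le (symMatrix x)
  rw [Fintype.card_fin] at this
  rw [if_neg (by omega)]

theorem sum_corankProb (n : ℕ) : ∑ r ∈ Finset.range (n + 1), corankProb F n r = 1 := by
  simp only [corankProb]
  rw [← Finset.mul_sum, Finset.sum_comm]
  have : ∀ x : UpperIdx n → F, (∑ r ∈ Finset.range (n + 1),
      if corank (symMatrix x) = r then (1 : ℝ) else 0) = 1 := by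
    intro x
    have := corank_le (symMatrix x)
    rw [Fintype.card_fin] at this
    rw [Finset.sum_ite_eq, if_pos (Finset.mem_range.2 (by omega))]
  simp only [this, Finset.sum_const, Finset.card_univ, nsmul_eq_mul, mul_one]
  exact inv_mul_cancel₀ (by simp)

/-- This is the Markov transition read backwards: corank `s` is reached from `s + 1`, `s` or `s -
1`. The conditional excludes the truncated predecessor of `0`. -/
theorem corankProb_succ (n s : ℕ) :
    corankProb F (n + 1) s =
      (1 - (Fintype.card F : ℝ)⁻¹ ^ (s + 1)) * corankProb F n (s + 1) +
      (Fintype.card F : ℝ)⁻¹ ^ s * (1 - (Fintype.card F : ℝ)⁻¹) * corankProb F n s +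
      if s = 0 then 0 else (Fintype.card F : ℝ)⁻¹ ^ s * corankProb F n (s - 1) := by
  classical
  set q : ℝ := (Fintype.card F : ℝ) with hq
  have hq0 : q ≠ 0 := by simp [hq]
  have hcard : (Fintype.card (UpperIdx (n + 1) → F) : ℝ) =
      Fintype.card (UpperIdx n → F) * q ^ (n + 1) := by
    rw [← Fintype.card_congr (borderEquiv F n), Fintype.card_prod, Fintype.card_prod]
    simp [hq, pow_succ]
  have key : ∀ x : UpperIdx n → F, (∑ v : Fin n → F, ∑ a : F,
      if corank (symMatrix (borderEquiv F n (x, v, a))) = s then (1 : ℝ) else 0) =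
      q ^ (n + 1) * ((1 - q⁻¹ ^ (s + 1)) * (if corank (symMatrix x) = s + 1 then 1 else 0) +
        q⁻¹ ^ s * (1 - q⁻¹) * (if corank (symMatrix x) = s then 1 else 0) +
        if s = 0 then 0 else q⁻¹ ^ s * if corank (symMatrix x) = s - 1 then 1 else 0) := by
    intro x
    simp only [symMatrix_borderEquiv]
    rw [sum_corank_border (symMatrix_isSymm x) fun c => if c = s then (1 : ℝ) else 0]
    congr 1
    rw [← hq]
    clear_value q
    generalize corank (symMatrix x) = r
    rcases Nat.lt_trichotomy r s with h | h | h
    · by_cases h1 : r + 1 = s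
      · subst h1
        simp [show r ≠ r + 1 + 1 by omega]
      · have h2 : r - 1 ≠ s := by omega
        have h3 : r ≠ s - 1 := by omega
        have h4 : r ≠ s := by omega
        have h5 : r ≠ s + 1 := by omega
        simp [h1, h2, h3, h4, h5]
    · subst h
      rcases r with _ | r
      · simp
      · simp
    · by_cases h1 : r = s + 1
      · subst h1
        have h3 : s + 1 ≠ s - 1 := by omega
        simp [h3, show s + 1 + 1 ≠ s by omega]
      · have h2 : r - 1 ≠ s := by omega
        have h3 : r ≠ s - 1 := by omega
        have h4 : r ≠ s := by omega
        have h5 : r + 1 ≠ s := by omega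
        simp [h1, h2, h3, h4, h5]
  rw [corankProb, ← (borderEquiv F n).sum_comp]
  simp only [Fintype.sum_prod_type, key]
  rw [hcard, ← Finset.mul_sum, Finset.sum_add_distrib, Finset.sum_add_distrib, ← Finset.mul_sum,
    ← Finset.mul_sum]
  simp only [corankProb]
  have hc : (Fintype.card (UpperIdx n → F) : ℝ) ≠ 0 := by simp
  split_ifs with hs
  · simp
    field_simp
  · rw [← Finset.mul_sum]
    field_simp

/-- `∏_{i = 1}^n (1 - t ^ i)`. -/
noncomputable def qPoch (t : ℝ) (n : ℕ) : ℝ := ∏ i ∈ Finset.range n, (1 - t ^ (i + 1))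

/-- `∏_{j = 1}^k (1 - t ^ (2 j))`. -/
noncomputable def evenPoch (t : ℝ) (k : ℕ) : ℝ := ∏ j ∈ Finset.range k, (1 - t ^ (2 * (j + 1)))

theorem qPoch_pos {t : ℝ} (h0 : 0 ≤ t) (h1 : t < 1) (n : ℕ) : 0 < qPoch t n :=
  Finset.prod_pos fun i _ => sub_pos.2 (pow_lt_one₀ h0 h1 (by omega))

theorem evenPoch_pos {t : ℝ} (h0 : 0 ≤ t) (h1 : t < 1) (n : ℕ) : 0 < evenPoch t n :=
  Finset.prod_pos fun i _ => sub_pos.2 (pow_lt_one₀ h0 h1 (by omega))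

theorem triangle_succ (s : ℕ) : (s + 1) * (s + 1 + 1) / 2 = s * (s + 1) / 2 + (s + 1) := by
  rw [show (s + 1) * (s + 1 + 1) = s * (s + 1) + (s + 1) * 2 by ring,
    Nat.add_mul_div_right _ _ two_pos]

/-- The formula is verified against the recurrence by induction on the size `r + k`; the initial
condition is the single matrix of size `0`. -/
theorem corankProb_eq (k r : ℕ) :
    corankProb F (r + k) r =
      (Fintype.card F : ℝ)⁻¹ ^ (r * (r + 1) / 2) * qPoch (Fintype.card F : ℝ)⁻¹ (r + k) /
        (qPoch (Fintype.card F : ℝ)⁻¹ r * evenPoch (Fintype.card F : ℝ)⁻¹ (k / 2)) := by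
  obtain ⟨n, hn⟩ : ∃ n, n = r + k := ⟨_, rfl⟩
  induction n generalizing r k with
  | zero =>
    obtain ⟨rfl, rfl⟩ : r = 0 ∧ k = 0 := by omega
    have := sum_corankProb (F := F) 0
    simpa [qPoch, evenPoch] using this
  | succ n ih =>
    rw [← hn, corankProb_succ]
    set t : ℝ := (Fintype.card F : ℝ)⁻¹ with ht
    have h0 : 0 ≤ t := by positivity
    have h1 : t < 1 := inv_lt_one_of_one_lt₀ (by exact_mod_cast Fintype.one_lt_card)
    have hq : ∀ m, qPoch t (m + 1) = qPoch t m * (1 - t ^ (m + 1)) := fun m =>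
      Finset.prod_range_succ _ _
    have he : ∀ m, evenPoch t (m + 1) = evenPoch t m * (1 - t ^ (2 * (m + 1))) := fun m =>
      Finset.prod_range_succ _ _
    have hqr := (qPoch_pos h0 h1 r).ne'
    have hep : ∀ m, evenPoch t m ≠ 0 := fun m => (evenPoch_pos h0 h1 m).ne'
    -- Over the denominator `qPoch t r` this contribution carries the factor `1 - t ^ r`, which is
    -- zero at `r = 0`; the conditional is thereby absorbed.
    have third : (if r = 0 then 0 else t ^ r * corankProb F n (r - 1)) =
        t ^ (r * (r + 1) / 2) * qPoch t n / (qPoch t r * evenPoch t (k / 2)) * (1 - t ^ r) := by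
      rcases r with _ | r
      · simp
      · have hn' : n = r + k := by omega
        have := ih k r hn'
        rw [← hn'] at this
        have hr1 : 1 - t ^ (r + 1) ≠ 0 := (sub_pos.2 (pow_lt_one₀ h0 h1 (by omega))).ne'
        have hqr' := (qPoch_pos h0 h1 r).ne'
        have hek := hep (k / 2)
        simp only [Nat.add_sub_cancel, this, triangle_succ, hq, pow_add t (r * (r + 1) / 2)]
        rw [if_neg (by omega)]
        field_simp
    rw [third, hq n]
    -- For `k = 0` and `k = 1` the terms with corank exceeding `n` vanish, and the induction
    -- hypothesis does not cover them.
    rcases k with _ | _ | k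
    · have hnr : n + 1 = r := by omega
      rw [corankProb_eq_zero (by omega : n < r + 1), corankProb_eq_zero (by omega : n < r), hnr]
      ring
    · obtain rfl : n = r := by omega
      have := ih 0 n rfl
      rw [Nat.add_zero] at this
      rw [corankProb_eq_zero (by omega : n < n + 1), this]
      simp only [Nat.zero_div, Nat.zero_add, Nat.reduceDiv]
      have := hep 0
      field_simp
      ring
    · have hA := ih k (r + 1) (by omega)
      have hB := ih (k + 1) r (by omega)
      rw [show r + 1 + k = n by omega] at hA
      rw [show r + (k + 1) = n by omega] at hB
      have hr1 : 1 - t ^ (r + 1) ≠ 0 := (sub_pos.2 (pow_lt_one₀ h0 h1 (by omega))).ne'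
      rw [hA, hB, triangle_succ, hq r, pow_add t (r * (r + 1) / 2)]
      -- The parity decides which of the three halved indices acquires the new factor of `evenPoch`.
      obtain ⟨j, rfl | rfl⟩ := Nat.even_or_odd' k
      · rw [show 2 * j / 2 = j by omega, show (2 * j + 1) / 2 = j by omega,
          show (2 * j + 1 + 1) / 2 = j + 1 by omega, he j, show n + 1 = r + 2 * (j + 1) by omega]
        have := hep j
        have : 1 - t ^ (2 * (j + 1)) ≠ 0 := (sub_pos.2 (pow_lt_one₀ h0 h1 (by omega))).ne'
        field_simp
        ring
      · rw [show (2 * j + 1) / 2 = j by omega, show (2 * j + 1 + 1) / 2 = j + 1 by omega,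
          show (2 * j + 1 + 1 + 1) / 2 = j + 1 by omega, he j,
          show n + 1 = r + 2 * (j + 1) + 1 by omega]
        have := hep j
        have : 1 - t ^ (2 * (j + 1)) ≠ 0 := (sub_pos.2 (pow_lt_one₀ h0 h1 (by omega))).ne'
        field_simp
        ring

end Count

/-- Take a basis adapted to `W ⊕ ker M`; pairings with the kernel vanish by symmetry. If `A` kills
`x`, the corresponding `w ∈ W` has `M w` orthogonal to the whole basis, so `w ∈ W ∩ ker M = 0`. No
diagonalization of the form is needed. -/
theorem exists_congruence_fromBlocks {F : Type*} [Field F] {n m r : ℕ}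
    {M : Matrix (Fin n) (Fin n) F} (hM : M.IsSymm) (hr : corank M = r)
    (e : Fin m ⊕ Fin r ≃ Fin n) :
    ∃ U : Matrix (Fin n) (Fin n) F, IsUnit U.det ∧ ∃ A : Matrix (Fin m) (Fin m) F, IsUnit A.det ∧
      (U * M * U.transpose).submatrix e e = Matrix.fromBlocks A 0 0 0 := by
  obtain ⟨W, hW⟩ := Submodule.exists_isCompl (LinearMap.ker M.mulVecLin)
  have hcard : m + r = n := by simpa using Fintype.card_congr e
  have hWm : Module.finrank F W = m := by
    have := Submodule.finrank_add_eq_of_isCompl hW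
    rw [Module.finrank_fintype_fun_eq_card, Fintype.card_fin] at this
    rw [corank] at hr
    omega
  let bK := Module.finBasisOfFinrankEq F (LinearMap.ker M.mulVecLin) hr
  let bW := Module.finBasisOfFinrankEq F W hWm
  let b : Module.Basis (Fin m ⊕ Fin r) F (Fin n → F) :=
    (bW.prod bK).map (Submodule.prodEquivOfIsCompl _ _ hW.symm)
  have hinl : ∀ i, b (Sum.inl i) = bW i := fun i => by simp [b]
  have hinr : ∀ j, b (Sum.inr j) = bK j := fun i => by simp [b]
  let U : Matrix (Fin n) (Fin n) F := Matrix.of fun i => b (e.symm i)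
  have hU : IsUnit U := by
    rw [← Matrix.linearIndependent_rows_iff_isUnit]
    exact b.linearIndependent.comp e.symm e.symm.injective
  have hUM : ∀ i j, (U * M * U.transpose) (e i) (e j) = b i ⬝ᵥ M.mulVec (b j) := by
    intro i j
    rw [Matrix.mul_assoc, Matrix.mul_apply]
    simp [U, dotProduct, Matrix.mul_apply, Matrix.mulVec]
  have hker : ∀ j, M.mulVec (b (Sum.inr j)) = 0 := by
    intro j
    rw [hinr]
    exact LinearMap.mem_ker.1 (bK j).2
  have hker' : ∀ j x, b (Sum.inr j) ⬝ᵥ M.mulVec x = 0 := by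
    intro j x
    rw [Matrix.dotProduct_mulVec, ← Matrix.mulVec_transpose, hM.eq, hker, zero_dotProduct]
  refine ⟨U, (Matrix.isUnit_iff_isUnit_det U).1 hU,
    Matrix.of fun i j => b (Sum.inl i) ⬝ᵥ M.mulVec (b (Sum.inl j)), ?_, ?_⟩
  · rw [isUnit_iff_ne_zero]
    intro hdet
    obtain ⟨x, hx, hAx⟩ := Matrix.exists_mulVec_eq_zero_iff.2 hdet
    set w : Fin n → F := ∑ i, x i • b (Sum.inl i) with hw
    have hMw : U.mulVec (M.mulVec w) = 0 := by
      ext i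
      obtain ⟨i, rfl⟩ := e.surjective i
      have : U.mulVec (M.mulVec w) (e i) = b i ⬝ᵥ M.mulVec w := by
        simp [U, Matrix.mulVec]
      rw [this]
      rcases i with i | i
      · have := congrFun hAx i
        simp only [Matrix.mulVec, dotProduct, Matrix.of_apply, Pi.zero_apply] at this
        rw [Pi.zero_apply, ← this, hw, Matrix.mulVec_sum, dotProduct_sum]
        refine Finset.sum_congr rfl fun j _ => ?_
        rw [Matrix.mulVec_smul, dotProduct_smul, smul_eq_mul, mul_comm]
        rfl
      · rw [hker']; rfl
    have hMw0 : M.mulVec w = 0 := by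
      have := (Matrix.mulVec_injective_iff_isUnit.2 hU) (hMw.trans (Matrix.mulVec_zero U).symm)
      exact this
    have hwW : w ∈ W := by
      refine Submodule.sum_mem _ fun i _ => Submodule.smul_mem _ _ ?_
      rw [hinl]
      exact (bW i).2
    have hw0 : w = 0 := by
      have := Submodule.disjoint_def.1 hW.disjoint w (by simpa using hMw0) hwW
      exact this
    refine hx (funext fun i => ?_)
    have hli := b.linearIndependent.comp Sum.inl Sum.inl_injective
    exact Fintype.linearIndependent_iff.1 hli x (by simpa [hw] using hw0) i
  · ext i j
    rw [Matrix.submatrix_apply, hUM]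
    rcases i with i | i <;> rcases j with j | j
    · simp
    · simp [hker]
    · simp [hker']
    · simp [hker]

/-! ### Elementary divisors, and their behaviour under splitting off a unit block. -/

section Types

variable {p : ℕ} [Fact p.Prime]

/-- The reduction of a matrix over `ℤ_[p]` modulo `p`. -/
noncomputable def red {m n : Type*} (X : Matrix m n ℤ_[p]) : Matrix m n (ZMod p) := X.map PadicInt.toZMod

theorem toZMod_eq_zero_iff (x : ℤ_[p]) : PadicInt.toZMod x = 0 ↔ (p : ℤ_[p]) ∣ x := by
  rw [← RingHom.mem_ker, PadicInt.ker_toZMod, PadicInt.maximalIdeal_eq_span_p,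
    Ideal.mem_span_singleton]

theorem toZMod_surjective : Function.Surjective (PadicInt.toZMod : ℤ_[p] →+* ZMod p) :=
  ZMod.ringHom_surjective _

theorem red_add {m n : Type*} (X Y : Matrix m n ℤ_[p]) : red (X + Y) = red X + red Y := by
  ext; simp [red]

theorem red_mul {l m n : Type*} [Fintype m] (X : Matrix l m ℤ_[p]) (Y : Matrix m n ℤ_[p]) :
    red (X * Y) = red X * red Y := Matrix.map_mul

theorem red_smul_p {m n : Type*} (X : Matrix m n ℤ_[p]) : red ((p : ℤ_[p]) • X) = 0 := by
  ext; simp [red]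

theorem exists_eq_smul_of_red_eq_zero {m n : Type*} {X : Matrix m n ℤ_[p]} (h : red X = 0) :
    ∃ Y : Matrix m n ℤ_[p], X = (p : ℤ_[p]) • Y := by
  have : ∀ i j, ∃ y, X i j = p * y := fun i j =>
    (toZMod_eq_zero_iff _).1 (congrFun (congrFun h i) j)
  choose Y hY using this
  exact ⟨Matrix.of Y, by ext i j; simpa using hY i j⟩

theorem exists_red_eq {m n : Type*} (M : Matrix m n (ZMod p)) :
    ∃ X : Matrix m n ℤ_[p], red X = M := by
  choose f hf using toZMod_surjective (p := p)
  exact ⟨M.map f, by ext; simp [red, hf]⟩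

theorem smul_p_injective {m n : Type*} :
    Function.Injective fun X : Matrix m n ℤ_[p] => (p : ℤ_[p]) • X := by
  intro X Y h
  ext i j
  have := congrFun (congrFun h i) j
  have hp : (p : ℤ_[p]) ≠ 0 := by exact_mod_cast (Fact.out : p.Prime).ne_zero
  simpa [hp] using this

variable {ι κ : Type*} [Fintype ι] [Fintype κ] [DecidableEq ι] [DecidableEq κ]

theorem isUnit_det_red {X : Matrix ι ι ℤ_[p]} : IsUnit (red X).det ↔ IsUnit X.det := by
  have : IsLocalHom (PadicInt.toZMod : ℤ_[p] →+* ZMod p) :=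
    IsLocalHom.of_surjective _ toZMod_surjective
  have h : (red X).det = PadicInt.toZMod X.det := (RingHom.map_det _ _).symm
  rw [h, isUnit_map_iff]

/-- `X` is non-singular and the positive exponents of its elementary divisors form `s`. -/
def HasParts (X : Matrix ι ι ℤ_[p]) (s : Multiset ℕ) : Prop :=
  ∃ (k : ι → ℕ) (U V : Matrix ι ι ℤ_[p]), IsUnit U.det ∧ IsUnit V.det ∧
    X = U * Matrix.diagonal (fun i => (p : ℤ_[p]) ^ k i) * V ∧
    ((Finset.univ : Finset ι).val.map k).filter (fun a => 0 < a) = s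

theorem hasType_iff {n : ℕ} (X : Matrix (Fin n) (Fin n) ℤ_[p]) (lam : IntPartition) :
    HasType X lam ↔ HasParts X lam.2.parts := by
  constructor
  · rintro ⟨k, ⟨U, V, h⟩, hk⟩
    exact ⟨k, U, V, (Matrix.isUnit_iff_isUnit_det _).1 U.isUnit,
      (Matrix.isUnit_iff_isUnit_det _).1 V.isUnit, h, hk⟩
  · rintro ⟨k, U, V, hU, hV, h, hk⟩
    obtain ⟨U, rfl⟩ := (Matrix.isUnit_iff_isUnit_det _).2 hU
    obtain ⟨V, rfl⟩ := (Matrix.isUnit_iff_isUnit_det _).2 hV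
    exact ⟨k, ⟨U, V, h⟩, hk⟩

theorem HasParts.pos {X : Matrix ι ι ℤ_[p]} {s : Multiset ℕ} (h : HasParts X s) :
    ∀ a ∈ s, 0 < a := by
  obtain ⟨k, U, V, -, -, -, rfl⟩ := h
  exact fun a ha => (Multiset.mem_filter.1 ha).2

theorem HasParts.card_le {X : Matrix ι ι ℤ_[p]} {s : Multiset ℕ} (h : HasParts X s) :
    s.card ≤ Fintype.card ι := by
  obtain ⟨k, U, V, -, -, -, rfl⟩ := h
  exact (Multiset.card_le_card (Multiset.filter_le _ _)).trans (by simp)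

theorem HasParts.mul {X : Matrix ι ι ℤ_[p]} {s : Multiset ℕ} (h : HasParts X s)
    {P Q : Matrix ι ι ℤ_[p]} (hP : IsUnit P.det) (hQ : IsUnit Q.det) :
    HasParts (P * X * Q) s := by
  obtain ⟨k, U, V, hU, hV, rfl, hk⟩ := h
  refine ⟨k, P * U, V * Q, ?_, ?_, by simp only [Matrix.mul_assoc], hk⟩
  · rw [Matrix.det_mul]; exact hP.mul hU
  · rw [Matrix.det_mul]; exact hV.mul hQ

theorem hasParts_mul_iff {X P Q : Matrix ι ι ℤ_[p]} {s : Multiset ℕ} (hP : IsUnit P.det)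
    (hQ : IsUnit Q.det) : HasParts (P * X * Q) s ↔ HasParts X s := by
  refine ⟨fun h => ?_, fun h => h.mul hP hQ⟩
  have := h.mul (P := P⁻¹) (Q := Q⁻¹) (Matrix.isUnit_nonsing_inv_det _ hP)
    (Matrix.isUnit_nonsing_inv_det _ hQ)
  rwa [Matrix.mul_assoc P, Matrix.nonsing_inv_mul_cancel_left _ _ hP, Matrix.mul_assoc X,
    Matrix.mul_nonsing_inv _ hQ, Matrix.mul_one] at this

theorem HasParts.submatrix {X : Matrix ι ι ℤ_[p]} {s : Multiset ℕ} (h : HasParts X s)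
    (e : κ ≃ ι) : HasParts (X.submatrix e e) s := by
  obtain ⟨k, U, V, hU, hV, rfl, hk⟩ := h
  refine ⟨k ∘ e, U.submatrix e e, V.submatrix e e, by simpa, by simpa, ?_, ?_⟩
  · rw [← Matrix.submatrix_mul_equiv _ _ e e e, ← Matrix.submatrix_mul_equiv _ _ e e e,
      Matrix.submatrix_diagonal_equiv]
    rfl
  · rw [← hk, ← Multiset.map_map]
    congr 2
    exact congrArg Finset.val (Finset.map_univ_equiv e)

theorem hasParts_submatrix_iff {X : Matrix ι ι ℤ_[p]} {s : Multiset ℕ} (e : κ ≃ ι) :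
    HasParts (X.submatrix e e) s ↔ HasParts X s := by
  refine ⟨fun h => ?_, fun h => h.submatrix e⟩
  simpa using h.submatrix e.symm

/-- Lower all parts by one and discard the zeros. -/
def predParts (s : Multiset ℕ) : Multiset ℕ := (s.map (· - 1)).filter fun a => 0 < a

/-- The cardinality recovers the number of discarded zeros. This is what makes `predParts`
invertible once the number of parts is known. -/
theorem eq_of_filter_pos_eq {a b : Multiset ℕ} (hc : a.card = b.card)
    (h : a.filter (fun x => 0 < x) = b.filter fun x => 0 < x) : a = b := by
  have key : ∀ c : Multiset ℕ, c = c.filter (fun x => 0 < x) +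
      Multiset.replicate (c.card - (c.filter fun x => 0 < x).card) 0 := by
    intro c
    have h1 := Multiset.filter_add_not (fun x => 0 < x) c
    have h2 := congrArg Multiset.card h1
    rw [Multiset.card_add] at h2
    conv_lhs => rw [← h1]
    congr 1
    rw [Multiset.eq_replicate]
    exact ⟨by omega, fun x hx => by have := (Multiset.mem_filter.1 hx).2; omega⟩
  rw [key a, key b, h, hc]

theorem rank_red_mul_diagonal_mul (k : ι → ℕ) {U V : Matrix ι ι ℤ_[p]} (hU : IsUnit U.det)
    (hV : IsUnit V.det) :
    (red (U * Matrix.diagonal (fun i => (p : ℤ_[p]) ^ k i) * V)).rank =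
      Fintype.card {i // k i = 0} := by
  have hD : red (Matrix.diagonal fun i => (p : ℤ_[p]) ^ k i) =
      Matrix.diagonal fun i => (0 : ZMod p) ^ k i := by
    rw [red, Matrix.diagonal_map (map_zero _)]
    simp
  rw [red_mul, red_mul, Matrix.rank_mul_eq_left_of_isUnit_det _ _ (isUnit_det_red.2 hV),
    Matrix.rank_mul_eq_right_of_isUnit_det _ _ (isUnit_det_red.2 hU), hD, Matrix.rank_diagonal]
  refine Fintype.card_congr (Equiv.subtypeEquivRight fun i => ?_)
  rw [ne_eq, pow_eq_zero_iff']
  simp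

/-- Modulo `p` only the diagonal entries with exponent zero survive. -/
theorem HasParts.corank_red {X : Matrix ι ι ℤ_[p]} {s : Multiset ℕ} (h : HasParts X s) :
    corank (red X) = s.card := by
  have := rank_add_corank (red X)
  obtain ⟨k, U, V, hU, hV, rfl, rfl⟩ := h
  rw [rank_red_mul_diagonal_mul k hU hV] at this
  have h2 : ((((Finset.univ : Finset ι).val.map k).filter fun a => 0 < a)).card =
      Fintype.card {i // ¬ k i = 0} := by
    rw [Multiset.filter_map, Multiset.card_map, Fintype.card_subtype]
    change (Finset.univ.filter _).card = _
    congr 1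
    ext i
    simp [Nat.pos_iff_ne_zero]
  have h3 := Fintype.card_subtype_compl fun i => k i = 0
  have h4 := Fintype.card_subtype_le fun i => k i = 0
  omega

theorem corank_red_fromBlocks {A : Matrix ι ι ℤ_[p]} (hA : IsUnit A.det) (Y : Matrix κ κ ℤ_[p]) :
    corank (red (Matrix.fromBlocks A 0 0 ((p : ℤ_[p]) • Y))) = Fintype.card κ := by
  have h : red (Matrix.fromBlocks A 0 0 ((p : ℤ_[p]) • Y)) =
      Matrix.fromBlocks (red A) 0 0 1 * Matrix.diagonal (Sum.elim (fun _ => 1) fun _ => 0) := by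
    rw [← Matrix.fromBlocks_diagonal, Matrix.fromBlocks_multiply]
    have := red_smul_p Y
    simp only [red] at this ⊢
    rw [Matrix.fromBlocks_map, this, Matrix.map_zero _ (map_zero _),
      Matrix.map_zero _ (map_zero _)]
    simp
  have hdet : IsUnit (Matrix.fromBlocks (red A) 0 0 (1 : Matrix κ κ (ZMod p))).det := by
    rw [Matrix.det_fromBlocks_zero₂₁, Matrix.det_one, mul_one]
    exact isUnit_det_red.2 hA
  have h1 := rank_add_corank (red (Matrix.fromBlocks A 0 0 ((p : ℤ_[p]) • Y)))
  have h2 : (red (Matrix.fromBlocks A 0 0 ((p : ℤ_[p]) • Y))).rank = Fintype.card ι := by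
    rw [h, Matrix.rank_mul_eq_right_of_isUnit_det _ _ hdet, Matrix.rank_diagonal]
    refine (Fintype.card_congr ?_).symm
    exact
      { toFun := fun i => ⟨Sum.inl i, one_ne_zero⟩
        invFun := fun
          | ⟨Sum.inl i, _⟩ => i
          | ⟨Sum.inr _, h⟩ => (h rfl).elim
        left_inv := fun _ => rfl
        right_inv := by
          rintro ⟨i | i, h⟩
          · rfl
          · exact (h rfl).elim }
  rw [h2, Fintype.card_sum] at h1
  omega

theorem HasParts.fromBlocks {A : Matrix ι ι ℤ_[p]} (hA : IsUnit A.det) {Y : Matrix κ κ ℤ_[p]}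
    {s : Multiset ℕ} (hs : ∀ a ∈ s, 0 < a) (hc : s.card = Fintype.card κ)
    (h : HasParts Y (predParts s)) :
    HasParts (Matrix.fromBlocks A 0 0 ((p : ℤ_[p]) • Y)) s := by
  obtain ⟨k, U, V, hU, hV, rfl, hk⟩ := h
  have hks : (Finset.univ : Finset κ).val.map k = s.map (· - 1) :=
    eq_of_filter_pos_eq (by simp [hc]) hk
  have hks' : (Finset.univ : Finset κ).val.map (fun i => k i + 1) = s := by
    have := congrArg (Multiset.map (· + 1)) hks
    rw [Multiset.map_map, Multiset.map_map] at this
    refine this.trans ?_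
    conv_rhs => rw [← Multiset.map_id s]
    exact Multiset.map_congr rfl fun a ha => Nat.sub_add_cancel (hs a ha)
  refine ⟨Sum.elim (fun _ => 0) fun i => k i + 1, Matrix.fromBlocks A 0 0 U,
    Matrix.fromBlocks 1 0 0 V, ?_, ?_, ?_, ?_⟩
  · rw [Matrix.det_fromBlocks_zero₂₁]
    exact hA.mul hU
  · rw [Matrix.det_fromBlocks_zero₂₁, Matrix.det_one, one_mul]
    exact hV
  · have : (Matrix.diagonal fun i => (p : ℤ_[p]) ^ Sum.elim (fun _ : ι => 0) (fun i => k i + 1) i) =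
        Matrix.fromBlocks (1 : Matrix ι ι ℤ_[p]) 0 0
          ((p : ℤ_[p]) • Matrix.diagonal fun i => (p : ℤ_[p]) ^ k i) := by
      ext (i | i) (j | j)
      · simp [Matrix.diagonal_apply, Matrix.one_apply]
      · simp
      · simp
      · simp [Matrix.diagonal_apply, pow_succ']
    rw [this]
    simp [Matrix.fromBlocks_multiply]
  · change ((Finset.univ.disjSum Finset.univ).val.map _).filter _ = s
    rw [Finset.val_disjSum, Multiset.disjSum, Multiset.map_add, Multiset.map_map, Multiset.map_map,
      Multiset.filter_add]
    simp only [Function.comp_def, Sum.elim_inl, Sum.elim_inr, hks']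
    rw [Multiset.filter_eq_self.2 hs, Multiset.filter_eq_nil.2, zero_add]
    intro a ha
    obtain ⟨_, _, rfl⟩ := Multiset.mem_map.1 ha
    simp

/-- Comparing ranks modulo `p` shows that exactly `card ι` exponents are zero. With these moved to
the first block, the two decompositions are compared blockwise: the off-diagonal blocks `c` and `b'`
vanish modulo `p`, so `d` and `d'` are invertible and `d Y = D d'` is a decomposition of `Y`. -/
theorem HasParts.of_fromBlocks {A : Matrix ι ι ℤ_[p]} (hA : IsUnit A.det) {Y : Matrix κ κ ℤ_[p]}
    {s : Multiset ℕ} (h : HasParts (Matrix.fromBlocks A 0 0 ((p : ℤ_[p]) • Y)) s) :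
    HasParts Y (predParts s) := by
  have hrank := rank_add_corank (red (Matrix.fromBlocks A 0 0 ((p : ℤ_[p]) • Y)))
  rw [corank_red_fromBlocks hA, Fintype.card_sum] at hrank
  obtain ⟨k, U, V, hU, hV, hX, hk⟩ := h
  rw [hX, rank_red_mul_diagonal_mul k hU hV] at hrank
  have hc0 : Fintype.card ι = Fintype.card {i // k i = 0} := by omega
  have hc1 : Fintype.card κ = Fintype.card {i // ¬ k i = 0} := by
    rw [Fintype.card_subtype_compl, ← hc0, Fintype.card_sum, Nat.add_sub_cancel_left]
  -- A permutation that makes `ι` index the zero exponents and `κ` the positive ones.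
  let e : ι ⊕ κ ≃ ι ⊕ κ := (Equiv.sumCongr (Fintype.equivOfCardEq hc0)
    (Fintype.equivOfCardEq hc1)).trans (Equiv.sumCompl fun i => k i = 0)
  have he0 : ∀ i, k (e (Sum.inl i)) = 0 := fun i => (Fintype.equivOfCardEq hc0 i).2
  have he1 : ∀ i, k (e (Sum.inr i)) ≠ 0 := fun i => (Fintype.equivOfCardEq hc1 i).2
  set U' := U.submatrix id e with hU'
  set V' := V.submatrix e id with hV'
  have hsign : IsUnit ((Equiv.Perm.sign e : ℤ) : ℤ_[p]) :=
    (Equiv.Perm.sign e).isUnit.map (Int.castRingHom ℤ_[p])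
  have hUu : IsUnit U'.det := by
    rw [hU', Matrix.det_permute']
    exact hsign.mul hU
  have hVu : IsUnit V'.det := by
    rw [hV', Matrix.det_permute]
    exact hsign.mul hV
  let D : Matrix κ κ ℤ_[p] := Matrix.diagonal fun i => (p : ℤ_[p]) ^ (k (e (Sum.inr i)) - 1)
  have hD : Matrix.diagonal (fun i => (p : ℤ_[p]) ^ k (e i)) =
      Matrix.fromBlocks (1 : Matrix ι ι ℤ_[p]) 0 0 ((p : ℤ_[p]) • D) := by
    ext (i | i) (j | j)
    · simp [Matrix.diagonal_apply, Matrix.one_apply, he0]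
    · simp
    · simp
    · simp only [Matrix.diagonal_apply, Sum.inr.injEq, Matrix.fromBlocks_apply₂₂,
        Matrix.smul_apply, smul_eq_mul, D]
      split_ifs
      · rw [← pow_succ', Nat.sub_add_cancel (Nat.pos_of_ne_zero (he1 i))]
      · simp
  have hX' : Matrix.fromBlocks A 0 0 ((p : ℤ_[p]) • Y) =
      U' * Matrix.fromBlocks (1 : Matrix ι ι ℤ_[p]) 0 0 ((p : ℤ_[p]) • D) * V' := by
    rw [hX, ← hD, hU', hV']
    have : (Matrix.diagonal fun i => (p : ℤ_[p]) ^ k (e i)) =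
        (Matrix.diagonal fun i => (p : ℤ_[p]) ^ k i).submatrix e e := by
      rw [Matrix.submatrix_diagonal_equiv]; rfl
    rw [this, Matrix.submatrix_mul_equiv, Matrix.submatrix_mul_equiv, Matrix.submatrix_id_id]
  have hW : U'⁻¹ * Matrix.fromBlocks A 0 0 ((p : ℤ_[p]) • Y) =
      Matrix.fromBlocks (1 : Matrix ι ι ℤ_[p]) 0 0 ((p : ℤ_[p]) • D) * V' := by
    rw [hX', Matrix.mul_assoc, Matrix.nonsing_inv_mul_cancel_left _ _ hUu]
  have hWu : IsUnit (U'⁻¹).det := Matrix.isUnit_nonsing_inv_det _ hUu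
  generalize U'⁻¹ = W at hW hWu
  rw [← Matrix.fromBlocks_toBlocks W] at hW hWu
  rw [← Matrix.fromBlocks_toBlocks V'] at hW hVu
  generalize W.toBlocks₁₁ = a at *
  generalize W.toBlocks₁₂ = b at *
  generalize W.toBlocks₂₁ = c at *
  generalize W.toBlocks₂₂ = d at *
  generalize V'.toBlocks₁₁ = a' at *
  generalize V'.toBlocks₁₂ = b' at *
  generalize V'.toBlocks₂₁ = c' at *
  generalize V'.toBlocks₂₂ = d' at *
  rw [Matrix.fromBlocks_multiply, Matrix.fromBlocks_multiply, Matrix.fromBlocks_inj] at hW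
  simp only [Matrix.mul_zero, add_zero, zero_add, Matrix.zero_mul, Matrix.one_mul,
    Matrix.mul_smul, Matrix.smul_mul] at hW
  obtain ⟨-, hb, hc, hd⟩ := hW
  have hdY : d * Y = D * d' := smul_p_injective hd
  have hc' : red c = 0 := by
    have : c = (p : ℤ_[p]) • (D * c') * A⁻¹ := by
      rw [← hc, Matrix.mul_nonsing_inv_cancel_right _ _ hA]
    rw [this, red_mul, red_smul_p, Matrix.zero_mul]
  have hb' : red b' = 0 := by rw [← hb, red_smul_p]
  have hdu : IsUnit d.det := by
    rw [← isUnit_det_red] at hWu ⊢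
    simp only [red] at hWu hc' ⊢
    rw [Matrix.fromBlocks_map, hc', Matrix.det_fromBlocks_zero₂₁] at hWu
    -- Modulo `p` the matrix `W` is block triangular, so its determinant is the product of those of
    -- `a` and `d`.
    exact isUnit_of_mul_isUnit_right hWu
  have hdu' : IsUnit d'.det := by
    rw [← isUnit_det_red] at hVu ⊢
    simp only [red] at hVu hb' ⊢
    rw [Matrix.fromBlocks_map, hb', Matrix.det_fromBlocks_zero₁₂] at hVu
    exact isUnit_of_mul_isUnit_right hVu
  refine ⟨fun i => k (e (Sum.inr i)) - 1, d⁻¹, d', Matrix.isUnit_nonsing_inv_det _ hdu, hdu',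
    ?_, ?_⟩
  · rw [Matrix.mul_assoc]
    change Y = d⁻¹ * (D * d')
    rw [← hdY, Matrix.nonsing_inv_mul_cancel_left _ _ hdu]
  · have hke : (Finset.univ : Finset (ι ⊕ κ)).val.map k =
        (Finset.univ : Finset (ι ⊕ κ)).val.map (k ∘ e) := by
      rw [← Multiset.map_map]
      congr 1
      exact (congrArg Finset.val (Finset.map_univ_equiv e)).symm
    have hs : s = (Finset.univ : Finset κ).val.map fun i => k (e (Sum.inr i)) := by
      rw [← hk, hke]
      change ((Finset.univ.disjSum Finset.univ).val.map _).filter _ = _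
      rw [Finset.val_disjSum, Multiset.disjSum, Multiset.map_add, Multiset.map_map,
        Multiset.map_map, Multiset.filter_add]
      simp only [Function.comp_def]
      rw [Multiset.filter_eq_nil.2, zero_add, Multiset.filter_eq_self.2]
      · intro x hx
        obtain ⟨i, _, rfl⟩ := Multiset.mem_map.1 hx
        exact Nat.pos_of_ne_zero (he1 i)
      · intro x hx
        obtain ⟨i, _, rfl⟩ := Multiset.mem_map.1 hx
        simp [he0]
    rw [predParts, hs, Multiset.map_map]
    rfl

theorem hasParts_fromBlocks_iff {A : Matrix ι ι ℤ_[p]} (hA : IsUnit A.det) (Y : Matrix κ κ ℤ_[p])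
    (s : Multiset ℕ) :
    HasParts (Matrix.fromBlocks A 0 0 ((p : ℤ_[p]) • Y)) s ↔
      (∀ a ∈ s, 0 < a) ∧ s.card = Fintype.card κ ∧ HasParts Y (predParts s) := by
  refine ⟨fun h => ⟨h.pos, ?_, h.of_fromBlocks hA⟩, fun h => HasParts.fromBlocks hA h.1 h.2.1 h.2.2⟩
  rw [← h.corank_red, corank_red_fromBlocks hA]

end Types

/-! ### The Schur complement over `ℤ_p`, and openness of the type. -/

section Schur

variable {p : ℕ} [Fact p.Prime]

theorem continuousAt_ringInverse {x : ℤ_[p]} (hx : IsUnit x) : ContinuousAt Ring.inverse x := by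
  obtain ⟨u, rfl⟩ := hx
  exact NormedRing.inverse_continuousAt u

/-- `S` is the Schur complement of the invertible block, after lifting to `ℤ_p` a congruence that
splits off the kernel of `M`. The first clause transports types; translation equivariance and
continuity are what determine the law of the complement on the fibre over `M`. -/
theorem exists_schur {n r : ℕ} {M : Matrix (Fin n) (Fin n) (ZMod p)} (hM : M.IsSymm)
    (hr : corank M = r) :
    ∃ S : Matrix (Fin n) (Fin n) ℤ_[p] → Matrix (Fin r) (Fin r) ℤ_[p],
      (∀ X, X.IsSymm → red X = M → ∃ Y, Y.IsSymm ∧ S X = (p : ℤ_[p]) • Y ∧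
        ∀ s, HasParts X s ↔ (∀ a ∈ s, 0 < a) ∧ s.card = r ∧ HasParts Y (predParts s)) ∧
      (∀ Y : Matrix (Fin r) (Fin r) ℤ_[p], Y.IsSymm → ∃ Z : Matrix (Fin n) (Fin n) ℤ_[p],
        Z.IsSymm ∧ red Z = 0 ∧ ∀ X, S (X + Z) = S X + (p : ℤ_[p]) • Y) ∧
      ContinuousOn S {X | red X = M} := by
  have hrn : r ≤ n := by simpa [hr] using corank_le M
  let e : Fin (n - r) ⊕ Fin r ≃ Fin n :=
    finSumFinEquiv.trans (finCongr (Nat.sub_add_cancel hrn))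
  obtain ⟨U₀, hU₀, A, hA, hUA⟩ := exists_congruence_fromBlocks hM hr e
  obtain ⟨U, rfl⟩ := exists_red_eq U₀
  rw [isUnit_det_red] at hU₀
  have hUt : IsUnit U.transpose.det := by rwa [Matrix.det_transpose]
  let T : Matrix (Fin n) (Fin n) ℤ_[p] → Matrix (Fin (n - r) ⊕ Fin r) (Fin (n - r) ⊕ Fin r) ℤ_[p] :=
    fun X => (U * X * U.transpose).submatrix e e
  have hTadd : ∀ X Z, T (X + Z) = T X + T Z := fun X Z => by
    simp only [T, Matrix.mul_add, Matrix.add_mul, Matrix.submatrix_add]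
    rfl
  have hTsymm : ∀ X, X.IsSymm → (T X).IsSymm := fun X hX => by
    refine Matrix.IsSymm.submatrix ?_ e
    rw [Matrix.IsSymm, Matrix.transpose_mul, Matrix.transpose_mul, hX.eq,
      Matrix.transpose_transpose, Matrix.mul_assoc]
  have hTred : ∀ X, red X = M → red (T X) = Matrix.fromBlocks A 0 0 0 := fun X hX => by
    rw [← hUA, ← hX]
    have : red U.transpose = (red U).transpose := rfl
    rw [← this, ← red_mul, ← red_mul]
    rfl
  have hT₁₁ : ∀ X, red X = M → IsUnit (T X).toBlocks₁₁.det := fun X hX => by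
    rw [← isUnit_det_red]
    have : red (T X).toBlocks₁₁ = (red (T X)).toBlocks₁₁ := rfl
    rwa [this, hTred X hX, Matrix.toBlocks_fromBlocks₁₁]
  refine ⟨fun X => (T X).toBlocks₂₂ - (T X).toBlocks₂₁ * (T X).toBlocks₁₁⁻¹ * (T X).toBlocks₁₂,
    fun X hX hXM => ?_, fun Y hY => ?_, ?_⟩
  · have h := hT₁₁ X hXM
    have hs := hTsymm X hX
    have h12 : (T X).toBlocks₁₂.transpose = (T X).toBlocks₂₁ := by
      ext i j; exact hs.apply _ _
    have h11 : (T X).toBlocks₁₁.transpose = (T X).toBlocks₁₁ := by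
      ext i j; exact hs.apply _ _
    have h22 : (T X).toBlocks₂₂.transpose = (T X).toBlocks₂₂ := by
      ext i j; exact hs.apply _ _
    have r12 : red (T X).toBlocks₁₂ = 0 := by
      have : red (T X).toBlocks₁₂ = (red (T X)).toBlocks₁₂ := rfl
      rw [this, hTred X hXM, Matrix.toBlocks_fromBlocks₁₂]
    have r22 : red (T X).toBlocks₂₂ = 0 := by
      have : red (T X).toBlocks₂₂ = (red (T X)).toBlocks₂₂ := rfl
      rw [this, hTred X hXM, Matrix.toBlocks_fromBlocks₂₂]
    set S := (T X).toBlocks₂₂ - (T X).toBlocks₂₁ * (T X).toBlocks₁₁⁻¹ * (T X).toBlocks₁₂ with hS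
    have hSred : red S = 0 := by
      have h := red_add S ((T X).toBlocks₂₁ * (T X).toBlocks₁₁⁻¹ * (T X).toBlocks₁₂)
      rwa [hS, sub_add_cancel, ← hS, red_mul, r12, r22, Matrix.mul_zero, add_zero, eq_comm] at h
    obtain ⟨Y, hY⟩ := exists_eq_smul_of_red_eq_zero hSred
    have hSsymm : S.transpose = S := by
      rw [hS, Matrix.transpose_sub, Matrix.transpose_mul, Matrix.transpose_mul, h12, h22,
        Matrix.transpose_nonsing_inv, h11, ← h12, Matrix.transpose_transpose, Matrix.mul_assoc]
    refine ⟨Y, ?_, hY, fun s => ?_⟩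
    · refine smul_p_injective ?_
      change (p : ℤ_[p]) • Y.transpose = (p : ℤ_[p]) • Y
      rw [← Matrix.transpose_smul, ← hY, hSsymm]
    -- Block elimination: the outer factors are unitriangular, so they do not affect the type.
    · have hfact : T X =
          Matrix.fromBlocks 1 0 ((T X).toBlocks₂₁ * (T X).toBlocks₁₁⁻¹) 1 *
            Matrix.fromBlocks (T X).toBlocks₁₁ 0 0 S *
            Matrix.fromBlocks 1 ((T X).toBlocks₁₁⁻¹ * (T X).toBlocks₁₂) 0 1 := by
        conv_lhs => rw [← Matrix.fromBlocks_toBlocks (T X)]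
        rw [Matrix.fromBlocks_multiply, Matrix.fromBlocks_multiply]
        simp only [Matrix.one_mul, Matrix.mul_one, Matrix.mul_zero, Matrix.zero_mul, add_zero,
          zero_add]
        rw [Matrix.mul_nonsing_inv_cancel_left _ _ h, Matrix.nonsing_inv_mul_cancel_right _ _ h,
          ← Matrix.mul_assoc, hS, add_sub_cancel]
      rw [← hasParts_mul_iff hU₀ hUt, ← hasParts_submatrix_iff e]
      change HasParts (T X) s ↔ _
      rw [hfact, hasParts_mul_iff (by simp) (by simp), hY, hasParts_fromBlocks_iff h,
        Fintype.card_fin]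
  · let B : Matrix (Fin (n - r) ⊕ Fin r) (Fin (n - r) ⊕ Fin r) ℤ_[p] := Matrix.fromBlocks 0 0 0 Y
    have hB : B.IsSymm := Matrix.IsSymm.fromBlocks (Matrix.isSymm_zero) (by simp) hY
    -- Undoing the congruence on `0 ⊕ pY`: adding `Z` alters only the lower right block, in which
    -- the complement is affine.
    let Z := (p : ℤ_[p]) • (U⁻¹ * B.submatrix e.symm e.symm * (U⁻¹).transpose)
    have hTZ : T Z = Matrix.fromBlocks 0 0 0 ((p : ℤ_[p]) • Y) := by
      simp only [T, Z, Matrix.mul_smul, Matrix.smul_mul]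
      rw [Matrix.mul_assoc U⁻¹, Matrix.mul_nonsing_inv_cancel_left _ _ hU₀, Matrix.mul_assoc,
        ← Matrix.transpose_mul, Matrix.mul_nonsing_inv _ hU₀, Matrix.transpose_one, Matrix.mul_one]
      ext i j
      rcases i with i | i <;> rcases j with j | j <;> simp [B]
    refine ⟨Z, ?_, red_smul_p _, fun X => ?_⟩
    · rw [Matrix.IsSymm, Matrix.transpose_smul, Matrix.transpose_mul, Matrix.transpose_mul,
        Matrix.transpose_transpose, (hB.submatrix _).eq, ← Matrix.mul_assoc]
    · have h11 : (T (X + Z)).toBlocks₁₁ = (T X).toBlocks₁₁ := by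
        ext i j; simp [hTadd, hTZ, Matrix.toBlocks₁₁]
      have h12 : (T (X + Z)).toBlocks₁₂ = (T X).toBlocks₁₂ := by
        ext i j; simp [hTadd, hTZ, Matrix.toBlocks₁₂]
      have h21 : (T (X + Z)).toBlocks₂₁ = (T X).toBlocks₂₁ := by
        ext i j; simp [hTadd, hTZ, Matrix.toBlocks₂₁]
      have h22 : (T (X + Z)).toBlocks₂₂ = (T X).toBlocks₂₂ + (p : ℤ_[p]) • Y := by
        ext i j; simp [hTadd, hTZ, Matrix.toBlocks₂₂]
      simp only [h11, h12, h21, h22]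
      abel
  · rw [continuousOn_iff_continuous_domRestrict]
    have hc : Continuous fun X : {X : Matrix (Fin n) (Fin n) ℤ_[p] // red X = M} => T X.1 :=
      (((continuous_const.matrix_mul continuous_subtype_val).matrix_mul
        continuous_const).matrix_submatrix e e)
    have h11 : Continuous fun X : {X : Matrix (Fin n) (Fin n) ℤ_[p] // red X = M} =>
        (T X.1).toBlocks₁₁ := hc.matrix_submatrix Sum.inl Sum.inl
    have h12 : Continuous fun X : {X : Matrix (Fin n) (Fin n) ℤ_[p] // red X = M} =>
        (T X.1).toBlocks₁₂ := hc.matrix_submatrix Sum.inl Sum.inr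
    have h21 : Continuous fun X : {X : Matrix (Fin n) (Fin n) ℤ_[p] // red X = M} =>
        (T X.1).toBlocks₂₁ := hc.matrix_submatrix Sum.inr Sum.inl
    have h22 : Continuous fun X : {X : Matrix (Fin n) (Fin n) ℤ_[p] // red X = M} =>
        (T X.1).toBlocks₂₂ := hc.matrix_submatrix Sum.inr Sum.inr
    have hinv : Continuous fun X : {X : Matrix (Fin n) (Fin n) ℤ_[p] // red X = M} =>
        (T X.1).toBlocks₁₁⁻¹ := by
      simp only [Matrix.inv_def]
      suffices h : Continuous fun X : {X : Matrix (Fin n) (Fin n) ℤ_[p] // red X = M} =>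
          Ring.inverse (T X.1).toBlocks₁₁.det from h.smul h11.matrix_adjugate
      rw [continuous_iff_continuousAt]
      intro X
      exact ContinuousAt.comp (f := fun X : {X : Matrix (Fin n) (Fin n) ℤ_[p] // red X = M} =>
        (T X.1).toBlocks₁₁.det) (continuousAt_ringInverse (hT₁₁ X.1 X.2))
        h11.matrix_det.continuousAt
    exact h22.sub ((h21.matrix_mul hinv).matrix_mul h12)

/-- A sufficiently divisible perturbation factors through the diagonal as `U D (pW) V`, and `1 + pW`
is invertible, so it can be absorbed into `V`. -/
theorem HasParts.add_pow_smul {n : ℕ} {X : Matrix (Fin n) (Fin n) ℤ_[p]} {s : Multiset ℕ}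
    (h : HasParts X s) :
    ∃ N : ℕ, ∀ Z : Matrix (Fin n) (Fin n) ℤ_[p], HasParts (X + (p : ℤ_[p]) ^ N • Z) s := by
  obtain ⟨k, U, V, hU, hV, rfl, hk⟩ := h
  -- The sum dominates every `k i`; the extra one leaves a factor `p` after division of row `i` by
  -- `p ^ k i`.
  refine ⟨∑ i, k i + 1, fun Z => ?_⟩
  let W : Matrix (Fin n) (Fin n) ℤ_[p] :=
    Matrix.of fun i j => (p : ℤ_[p]) ^ (∑ i, k i - k i) * (U⁻¹ * Z * V⁻¹) i j
  have hW : (p : ℤ_[p]) ^ (∑ i, k i + 1) • (U⁻¹ * Z * V⁻¹) =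
      Matrix.diagonal (fun i => (p : ℤ_[p]) ^ k i) * ((p : ℤ_[p]) • W) := by
    ext i j
    rw [Matrix.diagonal_mul]
    have hi : k i ≤ ∑ i, k i := Finset.single_le_sum (fun _ _ => Nat.zero_le _) (Finset.mem_univ i)
    conv_lhs => rw [← Nat.add_sub_cancel' hi]
    simp only [Matrix.smul_apply, smul_eq_mul, W, Matrix.of_apply, pow_add]
    ring
  have hZ : (p : ℤ_[p]) ^ (∑ i, k i + 1) • Z =
      U * ((p : ℤ_[p]) ^ (∑ i, k i + 1) • (U⁻¹ * Z * V⁻¹)) * V := by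
    rw [Matrix.mul_smul, Matrix.smul_mul, Matrix.mul_assoc U⁻¹,
      Matrix.mul_nonsing_inv_cancel_left _ _ hU, Matrix.nonsing_inv_mul_cancel_right _ _ hV]
  refine ⟨k, U, (1 + (p : ℤ_[p]) • W) * V, hU, ?_, ?_, hk⟩
  · rw [Matrix.det_mul]
    refine IsUnit.mul ?_ hV
    rw [← isUnit_det_red, red_add, red_smul_p, add_zero]
    simp [red]
  · rw [hZ, hW]
    simp only [Matrix.mul_add, Matrix.add_mul, Matrix.mul_assoc, Matrix.one_mul]

theorem isOpen_hasParts (n : ℕ) (s : Multiset ℕ) :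
    IsOpen {x : UpperIdx n → ℤ_[p] | HasParts (symMatrix x) s} := by
  rw [Metric.isOpen_iff]
  intro x hx
  obtain ⟨N, hN⟩ := HasParts.add_pow_smul hx
  have hp : 0 < (p : ℝ) := by exact_mod_cast (Fact.out : p.Prime).pos
  refine ⟨(p : ℝ) ^ (-N : ℤ), by positivity, fun y hy => ?_⟩
  have : ∀ i, ∃ z, y i - x i = (p : ℤ_[p]) ^ N * z := by
    intro i
    change (p : ℤ_[p]) ^ N ∣ y i - x i
    rw [← Ideal.mem_span_singleton, ← PadicInt.norm_le_pow_iff_mem_span_pow, ← dist_eq_norm]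
    exact (dist_le_pi_dist y x i).trans (Metric.mem_ball.1 hy).le
  choose z hz using this
  have h := hN (symMatrix z)
  have hy : symMatrix x + (p : ℤ_[p]) ^ N • symMatrix z = symMatrix y := by
    ext i j
    simp [symMatrix, ← hz]
  rwa [hy] at h

end Schur

/-! ### The law of the Schur complement given the reduction modulo `p`. -/

section Law

variable {p : ℕ} [Fact p.Prime]

instance instSecondCountablePadicInt : SecondCountableTopology ℤ_[p] :=
  EMetric.secondCountable_of_sigmaCompact ℤ_[p]

instance instIsAddHaarMeasureHaar : (haar p).IsAddHaarMeasure := by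
  unfold haar; infer_instance

instance instIsAddHaarMeasureEntryLaw (n : ℕ) : (entryLaw p n).IsAddHaarMeasure := by
  unfold entryLaw; infer_instance

instance instIsProbabilityMeasureEntryLaw (n : ℕ) : IsProbabilityMeasure (entryLaw p n) := by
  unfold entryLaw; infer_instance

/-- Entrywise reduction modulo `p`. -/
noncomputable def redEntries {n : ℕ} (x : UpperIdx n → ℤ_[p]) : UpperIdx n → ZMod p :=
  fun i => PadicInt.toZMod (x i)

theorem red_symMatrix {n : ℕ} (x : UpperIdx n → ℤ_[p]) :
    red (symMatrix x) = symMatrix (redEntries x) := rfl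

theorem redEntries_add {n : ℕ} (x y : UpperIdx n → ℤ_[p]) :
    redEntries (x + y) = redEntries x + redEntries y := by
  ext i; simp [redEntries]

theorem redEntries_surjective (n : ℕ) :
    Function.Surjective (redEntries : (UpperIdx n → ℤ_[p]) → UpperIdx n → ZMod p) := by
  intro M
  choose f hf using toZMod_surjective (p := p)
  exact ⟨fun i => f (M i), funext fun i => hf _⟩

theorem isOpen_redEntries_eq {n : ℕ} (M : UpperIdx n → ZMod p) :
    IsOpen {x : UpperIdx n → ℤ_[p] | redEntries x = M} := by
  rw [Metric.isOpen_iff]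
  rintro x rfl
  refine ⟨1, one_pos, fun y hy => funext fun i => ?_⟩
  rw [redEntries, redEntries, ← sub_eq_zero, ← map_sub, toZMod_eq_zero_iff,
    ← PadicInt.norm_lt_one_iff_dvd, ← dist_eq_norm]
  exact (dist_le_pi_dist y x i).trans_lt (Metric.mem_ball.1 hy)

/-- The fibres of the reduction are translates of one another and partition the space. -/
theorem entryLaw_redEntries_eq {n : ℕ} (M : UpperIdx n → ZMod p) :
    entryLaw p n {x | redEntries x = M} = (Fintype.card (UpperIdx n → ZMod p) : ENNReal)⁻¹ := by
  have h1 : ∀ M' : UpperIdx n → ZMod p,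
      entryLaw p n {x | redEntries x = M'} = entryLaw p n {x | redEntries x = M} := by
    intro M'
    obtain ⟨z, hz⟩ := redEntries_surjective n (M - M')
    rw [← measure_preimage_add (entryLaw p n) z {x | redEntries x = M}]
    congr 1
    ext x
    simp [redEntries_add, hz, sub_add_eq_add_sub, sub_eq_iff_eq_add]
  have h2 : ∑ M' : UpperIdx n → ZMod p, entryLaw p n {x | redEntries x = M'} = 1 := by
    rw [← measure_biUnion_finset, ← measure_univ (μ := entryLaw p n)]
    · congr 1
      ext x
      simp
    · intro a _ b _ hab
      rw [Function.onFun, Set.disjoint_left]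
      rintro x rfl h
      exact hab h
    · exact fun M' _ => (isOpen_redEntries_eq M').measurableSet
  simp only [h1, Finset.sum_const, Finset.card_univ, nsmul_eq_mul] at h2
  exact ENNReal.eq_inv_of_mul_eq_one_left (by rwa [mul_comm])

/-- The parts of `symMatrix x` are those of `symMatrix y` raised by one, zeros included. -/
def ReducesTo {n r : ℕ} (x : UpperIdx n → ℤ_[p]) (y : UpperIdx r → ℤ_[p]) : Prop :=
  ∀ s, HasParts (symMatrix x) s ↔
    (∀ a ∈ s, 0 < a) ∧ s.card = r ∧ HasParts (symMatrix y) (predParts s)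

theorem symMatrix_injective {R : Type*} (n : ℕ) :
    Function.Injective (symMatrix : (UpperIdx n → R) → Matrix (Fin n) (Fin n) R) :=
  Function.LeftInverse.injective upper_symMatrix

theorem continuous_symMatrix (n : ℕ) :
    Continuous (symMatrix : (UpperIdx n → ℤ_[p]) → Matrix (Fin n) (Fin n) ℤ_[p]) :=
  continuous_matrix fun _ _ => continuous_apply _

/-- Given the reduction `M`, the reduced matrix `Y` is again Haar distributed: its law on the fibre
is translation invariant, hence a multiple of Haar measure, and the multiple is the mass of the
fibre. -/
theorem entryLaw_redEntries_inter {n r : ℕ} {M : UpperIdx n → ZMod p}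
    (hr : corank (symMatrix M) = r) {E : Set (UpperIdx n → ℤ_[p])} {E' : Set (UpperIdx r → ℤ_[p])}
    (hE' : MeasurableSet E')
    (hE : ∀ x y, redEntries x = M → ReducesTo x y → (x ∈ E ↔ y ∈ E')) :
    entryLaw p n ({x | redEntries x = M} ∩ E) =
      entryLaw p n {x | redEntries x = M} * entryLaw p r E' := by
  classical
  obtain ⟨S, hS1, hS2, hS3⟩ := exists_schur (symMatrix_isSymm M) hr
  set C := {x : UpperIdx n → ℤ_[p] | redEntries x = M} with hC
  have hCm : MeasurableSet C := (isOpen_redEntries_eq M).measurableSet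
  let g : (UpperIdx r → ℤ_[p]) → Matrix (Fin r) (Fin r) ℤ_[p] := fun y =>
    (p : ℤ_[p]) • symMatrix y
  have hgc : Continuous g := (continuous_symMatrix r).const_smul (p : ℤ_[p])
  -- Being an embedding, multiplication by `p` lets continuity of `S` pass to the pointwise chosen
  -- quotient `Φ`.
  have hg : IsClosedEmbedding g := hgc.isClosedEmbedding (smul_p_injective.comp (symMatrix_injective r))
  have hΦ : ∀ x, ∃ y, x ∈ C → S (symMatrix x) = g y ∧ ReducesTo x y := by
    intro x
    by_cases hx : x ∈ C
    · obtain ⟨Y, hY, hSY, hYs⟩ := hS1 (symMatrix x) (symMatrix_isSymm x)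
        (by rw [red_symMatrix]; exact congrArg _ hx)
      refine ⟨upper Y, fun _ => ?_⟩
      rw [ReducesTo, symMatrix_upper hY]
      exact ⟨by rw [hSY]; simp only [g, symMatrix_upper hY], hYs⟩
    · exact ⟨0, fun h => (hx h).elim⟩
  choose Φ hΦ using hΦ
  have hΦc : ContinuousOn Φ C := by
    rw [hg.isInducing.continuousOn_iff]
    refine ContinuousOn.congr (f := fun x => S (symMatrix x)) ?_ fun x hx => (hΦ x hx).1.symm
    refine hS3.comp (continuous_symMatrix n).continuousOn fun x hx => ?_
    change red (symMatrix x) = _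
    rw [red_symMatrix]; exact congrArg _ hx
  -- `Φ` is uncontrolled off the fibre; replacing it there by `0` makes it measurable without
  -- changing the restricted measure's image.
  have hΨ : Measurable (C.piecewise Φ 0) := hΦc.measurable_piecewise continuousOn_const hCm
  let ν := ((entryLaw p n).restrict C).map (C.piecewise Φ 0)
  have hν : ∀ B, MeasurableSet B → ν B = entryLaw p n (C ∩ Φ ⁻¹' B) := by
    intro B hB
    rw [Measure.map_apply hΨ hB, Measure.restrict_apply (hΨ hB)]
    congr 1
    ext x
    simp only [Set.mem_inter_iff, Set.mem_preimage]
    constructor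
    · rintro ⟨h, hx⟩
      rw [Set.piecewise_eq_of_mem _ _ _ hx] at h
      exact ⟨hx, h⟩
    · rintro ⟨hx, h⟩
      rw [Set.piecewise_eq_of_mem _ _ _ hx]
      exact ⟨h, hx⟩
  have hinv : ν.IsAddLeftInvariant := by
    refine ⟨fun y => ?_⟩
    ext B hB
    rw [Measure.map_apply (measurable_const_add y) hB, hν _ (measurable_const_add y hB), hν B hB]
    obtain ⟨Z, hZ, hZr, hZS⟩ := hS2 (symMatrix y) (symMatrix_isSymm y)
    rw [← measure_preimage_add (entryLaw p n) (upper Z) (C ∩ Φ ⁻¹' B)]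
    congr 1
    have hz0 : redEntries (upper Z) = 0 := by
      ext i
      exact congrFun (congrFun hZr _) _
    ext x
    have hxC : upper Z + x ∈ C ↔ x ∈ C := by
      simp [hC, redEntries_add, hz0]
    simp only [Set.mem_inter_iff, Set.mem_preimage, hxC]
    refine and_congr_right fun hx => ?_
    have : Φ (upper Z + x) = y + Φ x := by
      apply hg.injective
      rw [← (hΦ _ (hxC.2 hx)).1]
      have hadd : symMatrix (upper Z + x) = symMatrix x + Z := by
        conv_rhs => rw [← symMatrix_upper hZ]
        ext i j
        simp [symMatrix, add_comm]
      rw [hadd, hZS, (hΦ x hx).1]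
      ext i j
      simp [g, symMatrix]
      ring
    rw [this]
  have hsm := Measure.isAddLeftInvariant_eq_smul ν (entryLaw p r)
  generalize ν.addHaarScalarFactor (entryLaw p r) = c at hsm
  have huniv : entryLaw p n C = c := by
    have := hν Set.univ MeasurableSet.univ
    rw [hsm] at this
    simpa using this.symm
  have hE2 := hν E' hE'
  rw [hsm, Measure.smul_apply, ENNReal.smul_def, smul_eq_mul] at hE2
  rw [huniv]
  convert hE2.symm using 2
  ext x
  simp only [Set.mem_inter_iff, Set.mem_preimage]
  exact and_congr_right fun hx => hE x _ hx (hΦ x hx).2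

end Law

/-! ### Recursion over the corank, uniqueness of the type, and total mass one. -/

section Recursion

variable {p : ℕ} [Fact p.Prime]

theorem entryLaw_real_corank_inter {n r : ℕ} {E : Set (UpperIdx n → ℤ_[p])}
    {E' : Set (UpperIdx r → ℤ_[p])} (hEm : MeasurableSet E) (hE' : MeasurableSet E')
    (hE : ∀ x y, corank (red (symMatrix x)) = r → ReducesTo x y → (x ∈ E ↔ y ∈ E')) :
    (entryLaw p n).real ({x | corank (red (symMatrix x)) = r} ∩ E) =
      corankProb (ZMod p) n r * (entryLaw p r).real E' := by
  classical
  have hU : {x : UpperIdx n → ℤ_[p] | corank (red (symMatrix x)) = r} ∩ E =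
      ⋃ M ∈ Finset.univ.filter fun M : UpperIdx n → ZMod p => corank (symMatrix M) = r,
        ({x | redEntries x = M} ∩ E) := by
    ext x
    simp [red_symMatrix]
  rw [hU, measureReal_biUnion_finset]
  · have : ∀ M ∈ Finset.univ.filter fun M : UpperIdx n → ZMod p => corank (symMatrix M) = r,
        (entryLaw p n).real ({x | redEntries x = M} ∩ E) =
          (Fintype.card (UpperIdx n → ZMod p) : ℝ)⁻¹ * (entryLaw p r).real E' := by
      intro M hM
      have hM := (Finset.mem_filter.1 hM).2
      rw [measureReal_def, entryLaw_redEntries_inter hM hE', entryLaw_redEntries_eq,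
        ENNReal.toReal_mul, ENNReal.toReal_inv, ENNReal.toReal_natCast, measureReal_def]
      rintro x y rfl hxy
      exact hE x y hM hxy
    rw [Finset.sum_congr rfl this, Finset.sum_const, nsmul_eq_mul, corankProb, Finset.sum_boole]
    ring
  · intro a _ b _ hab
    rw [Function.onFun, Set.disjoint_left]
    rintro x ⟨rfl, -⟩ ⟨h, -⟩
    exact hab h
  · exact fun M _ => (isOpen_redEntries_eq M).measurableSet.inter hEm

theorem exists_reducesTo {n r : ℕ} (x : UpperIdx n → ℤ_[p])
    (hr : corank (red (symMatrix x)) = r) : ∃ y : UpperIdx r → ℤ_[p], ReducesTo x y := by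
  rw [red_symMatrix] at hr
  obtain ⟨S, hS, -⟩ := exists_schur (symMatrix_isSymm _) hr
  obtain ⟨Y, hY, -, h⟩ := hS (symMatrix x) (symMatrix_isSymm x) rfl
  refine ⟨upper Y, fun s => ?_⟩
  rw [symMatrix_upper hY, h]

theorem sum_predParts_add_card {s : Multiset ℕ} (hs : ∀ a ∈ s, 0 < a) :
    (predParts s).sum + s.card = s.sum := by
  have h1 : (predParts s).sum = (s.map (· - 1)).sum := by
    rw [predParts]
    conv_rhs => rw [← Multiset.filter_add_not (fun a => 0 < a) (s.map (· - 1)), Multiset.sum_add]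
    rw [left_eq_add]
    exact Multiset.sum_eq_zero fun x hx => by
      have := (Multiset.mem_filter.1 hx).2
      omega
  rw [h1]
  clear h1
  induction s using Multiset.induction_on with
  | empty => simp
  | cons a s ih =>
    have ha := hs a (Multiset.mem_cons_self _ _)
    have := ih fun b hb => hs b (Multiset.mem_cons_of_mem hb)
    rw [Multiset.map_cons, Multiset.sum_cons, Multiset.sum_cons, Multiset.card_cons]
    omega

theorem eq_of_predParts_eq {s t : Multiset ℕ} (hs : ∀ a ∈ s, 0 < a) (ht : ∀ a ∈ t, 0 < a)
    (hc : s.card = t.card) (h : predParts s = predParts t) : s = t := by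
  have key : ∀ u : Multiset ℕ, (∀ a ∈ u, 0 < a) → (u.map (· - 1)).map (· + 1) = u := by
    intro u hu
    rw [Multiset.map_map]
    conv_rhs => rw [← Multiset.map_id u]
    exact Multiset.map_congr rfl fun a ha => Nat.sub_add_cancel (hu a ha)
  rw [← key s hs, ← key t ht, eq_of_filter_pos_eq (by simp [hc]) h]

/-- Both types have as many parts as the corank modulo `p`, and their predecessors are types of the
same smaller matrix. Each reduction lowers the sum by the number of parts, so the descent ends when
there are none. -/
theorem HasParts.unique {n : ℕ} {x : UpperIdx n → ℤ_[p]} {s t : Multiset ℕ}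
    (hs : HasParts (symMatrix x) s) (ht : HasParts (symMatrix x) t) : s = t := by
  obtain ⟨N, hN⟩ : ∃ N, N = s.sum := ⟨_, rfl⟩
  induction N using Nat.strong_induction_on generalizing n s t with
  | _ N ih =>
    obtain ⟨y, hy⟩ := exists_reducesTo x rfl
    obtain ⟨hs0, hsc, hs'⟩ := (hy s).1 hs
    obtain ⟨ht0, htc, ht'⟩ := (hy t).1 ht
    have hc : s.card = t.card := hsc.trans htc.symm
    rcases Nat.eq_zero_or_pos s.card with h0 | h0
    · rw [Multiset.card_eq_zero.1 h0, Multiset.card_eq_zero.1 (hc.symm.trans h0)]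
    · have := sum_predParts_add_card hs0
      exact eq_of_predParts_eq hs0 ht0 hc (ih _ (by omega) hs' ht' rfl)

/-- Raise every part and pad with ones, which become the discarded zeros. -/
theorem exists_predParts_eq {s : Multiset ℕ} {r : ℕ} (hs : ∀ a ∈ s, 0 < a) (hr : s.card ≤ r) :
    ∃ t : Multiset ℕ, (∀ a ∈ t, 0 < a) ∧ t.card = r ∧ predParts t = s := by
  refine ⟨s.map (· + 1) + Multiset.replicate (r - s.card) 1, ?_, ?_, ?_⟩
  · intro a ha
    rcases Multiset.mem_add.1 ha with ha | ha
    · obtain ⟨b, -, rfl⟩ := Multiset.mem_map.1 ha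
      omega
    · rw [Multiset.eq_of_mem_replicate ha]
      exact one_pos
  · simp [hr]
  · rw [predParts, Multiset.map_add, Multiset.map_map, Multiset.map_replicate,
      Multiset.filter_add, (Multiset.filter_eq_nil (s := Multiset.replicate _ _)).2, add_zero]
    · simpa [Function.comp_def] using hs
    · intro a ha
      rw [Multiset.eq_of_mem_replicate ha]
      simp

theorem measurableSet_hasParts (n : ℕ) (s : Multiset ℕ) :
    MeasurableSet {x : UpperIdx n → ℤ_[p] | HasParts (symMatrix x) s} :=
  (isOpen_hasParts n s).measurableSet

theorem measurableSet_corank_red (n r : ℕ) :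
    MeasurableSet {x : UpperIdx n → ℤ_[p] | corank (red (symMatrix x)) = r} := by
  have : {x : UpperIdx n → ℤ_[p] | corank (red (symMatrix x)) = r} =
      ⋃ M ∈ {M : UpperIdx n → ZMod p | corank (symMatrix M) = r}, {x | redEntries x = M} := by
    ext x
    simp [red_symMatrix]
  rw [this]
  exact (isOpen_biUnion fun M _ => isOpen_redEntries_eq M).measurableSet

theorem measurableSet_forall_not_hasParts (n : ℕ) :
    MeasurableSet {x : UpperIdx n → ℤ_[p] | ∀ s, ¬ HasParts (symMatrix x) s} := by
  simp only [Set.ofPred_forall]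
  exact MeasurableSet.iInter fun s => (measurableSet_hasParts n s).compl

theorem ReducesTo.forall_not_hasParts_iff {n r : ℕ} {x : UpperIdx n → ℤ_[p]}
    {y : UpperIdx r → ℤ_[p]} (h : ReducesTo x y) :
    (∀ s, ¬ HasParts (symMatrix x) s) ↔ ∀ s, ¬ HasParts (symMatrix y) s := by
  constructor
  · intro hx s hs
    obtain ⟨t, ht0, htc, rfl⟩ := exists_predParts_eq hs.pos (by simpa using hs.card_le)
    exact hx t ((h t).2 ⟨ht0, htc, hs⟩)
  · exact fun hy s hs => hy _ ((h s).1 hs).2.2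

theorem corankProb_self_lt_one {n : ℕ} (hn : 0 < n) : corankProb (ZMod p) n n < 1 := by
  have := corankProb_eq (F := ZMod p) 0 n
  rw [Nat.add_zero] at this
  have hp : 1 < (p : ℝ) := by exact_mod_cast (Fact.out : p.Prime).one_lt
  have h0 : 0 ≤ (p : ℝ)⁻¹ := by positivity
  have h1 : (p : ℝ)⁻¹ < 1 := inv_lt_one_of_one_lt₀ hp
  have hq := (qPoch_pos h0 h1 n).ne'
  rw [this, ZMod.card]
  simp only [Nat.zero_div, evenPoch, Finset.range_zero, Finset.prod_empty, mul_one]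
  rw [mul_div_assoc, div_self hq, mul_one]
  refine pow_lt_one₀ h0 h1 ?_
  have : 2 ≤ n * (n + 1) := by nlinarith
  omega

theorem hasParts_zero (x : UpperIdx 0 → ℤ_[p]) : HasParts (symMatrix x) 0 :=
  ⟨fun _ => 0, 1, 1, by simp, by simp, Subsingleton.elim _ _, rfl⟩

/-- Having no type passes to the reduced matrix. By induction only corank `n` contributes, so the
probability `P` satisfies `P = corankProb n n * P`, and the coefficient is less than one. -/
theorem entryLaw_forall_not_hasParts (n : ℕ) :
    (entryLaw p n).real {x | ∀ s, ¬ HasParts (symMatrix x) s} = 0 := by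
  induction n using Nat.strong_induction_on with
  | _ n ih =>
    rcases Nat.eq_zero_or_pos n with rfl | hn
    · have : {x : UpperIdx 0 → ℤ_[p] | ∀ s, ¬ HasParts (symMatrix x) s} = ∅ := by
        rw [Set.eq_empty_iff_forall_notMem]
        intro x hx
        exact hx 0 (hasParts_zero x)
      rw [this, measureReal_empty]
    · have hU : {x : UpperIdx n → ℤ_[p] | ∀ s, ¬ HasParts (symMatrix x) s} =
          ⋃ r ∈ Finset.range (n + 1), ({x | corank (red (symMatrix x)) = r} ∩
            {x : UpperIdx n → ℤ_[p] | ∀ s, ¬ HasParts (symMatrix x) s}) := by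
        ext x
        have := corank_le (red (symMatrix x))
        rw [Fintype.card_fin] at this
        simp only [Set.mem_iUnion, Set.mem_inter_iff, Set.mem_ofPred_eq, Finset.mem_range]
        exact ⟨fun h => ⟨_, Nat.lt_succ_of_le this, rfl, h⟩, fun ⟨_, _, _, h⟩ => h⟩
      have hm := measurableSet_forall_not_hasParts (p := p) n
      have hrec : ∀ r, (entryLaw p n).real ({x | corank (red (symMatrix x)) = r} ∩
          {x | ∀ s, ¬ HasParts (symMatrix x) s}) =
          corankProb (ZMod p) n r * (entryLaw p r).real {x | ∀ s, ¬ HasParts (symMatrix x) s} :=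
        fun r => entryLaw_real_corank_inter hm (measurableSet_forall_not_hasParts r)
          fun x y _ h => h.forall_not_hasParts_iff
      have hsum := congrArg (entryLaw p n).real hU
      rw [measureReal_biUnion_finset] at hsum
      · simp only [hrec] at hsum
        rw [Finset.sum_range_succ, Finset.sum_eq_zero, zero_add] at hsum
        · have := corankProb_self_lt_one (p := p) hn
          have h2 : (1 - corankProb (ZMod p) n n) *
            (entryLaw p n).real {x | ∀ s, ¬ HasParts (symMatrix x) s} = 0 := by linarith
          exact (mul_eq_zero.1 h2).resolve_left (by linarith)
        · intro r hr
          rw [ih r (Finset.mem_range.1 hr), mul_zero]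
      · intro a _ b _ hab
        rw [Function.onFun, Set.disjoint_left]
        rintro x ⟨rfl, -⟩ ⟨h, -⟩
        exact hab h
      · intro r _
        exact (measurableSet_corank_red n r).inter hm

theorem entryLaw_hasParts {n : ℕ} {s : Multiset ℕ} (hs : ∀ a ∈ s, 0 < a) :
    (entryLaw p n).real {x | HasParts (symMatrix x) s} =
      corankProb (ZMod p) n s.card *
        (entryLaw p s.card).real {x | HasParts (symMatrix x) (predParts s)} := by
  rw [← entryLaw_real_corank_inter (measurableSet_hasParts n s)
    (measurableSet_hasParts s.card (predParts s))]
  · congr 1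
    ext x
    exact ⟨fun h => ⟨HasParts.corank_red h, h⟩, fun h => h.2⟩
  · intro x y _ h
    exact (h s).trans ⟨fun h => h.2.2, fun h => ⟨hs, rfl, h⟩⟩

theorem hasSum_fn (n : ℕ) : HasSum (fun lam : IntPartition => fn p n lam) 1 := by
  have hinj : ∀ lam mu : IntPartition, lam.2.parts = mu.2.parts → lam = mu := by
    rintro ⟨a, P⟩ ⟨b, Q⟩ h
    obtain rfl : a = b := by rw [← P.parts_sum, ← Q.parts_sum]; exact congrArg _ h
    exact congrArg _ (Nat.Partition.ext h)
  have hm : ∀ lam : IntPartition,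
      MeasurableSet {x : UpperIdx n → ℤ_[p] | HasType (symMatrix x) lam} := fun lam => by
    simp only [hasType_iff]
    exact measurableSet_hasParts n _
  have hd : Pairwise (Function.onFun Disjoint fun lam : IntPartition =>
      {x : UpperIdx n → ℤ_[p] | HasType (symMatrix x) lam}) := by
    intro lam mu hne
    rw [Function.onFun, Set.disjoint_left]
    intro x hx hy
    exact hne (hinj _ _ (HasParts.unique ((hasType_iff _ _).1 hx) ((hasType_iff _ _).1 hy)))
  have hU : (⋃ lam : IntPartition, {x : UpperIdx n → ℤ_[p] | HasType (symMatrix x) lam}) =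
      {x | ∀ s, ¬ HasParts (symMatrix x) s}ᶜ := by
    ext x
    simp only [Set.mem_iUnion, Set.mem_ofPred_eq, hasType_iff, Set.mem_compl_iff, not_forall,
      not_not]
    exact ⟨fun ⟨lam, h⟩ => ⟨_, h⟩, fun ⟨s, h⟩ => ⟨⟨s.sum, s, fun hi => h.pos _ hi, rfl⟩, h⟩⟩
  have h1 : (entryLaw p n) {x | ∀ s, ¬ HasParts (symMatrix x) s}ᶜ = 1 := by
    rw [prob_compl_eq_one_iff (measurableSet_forall_not_hasParts n)]
    exact (measureReal_eq_zero_iff).1 (entryLaw_forall_not_hasParts n)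
  have h2 := measure_iUnion (μ := entryLaw p n) hd hm
  rw [hU, h1] at h2
  have h3 := ENNReal.hasSum_toReal (f := fun lam : IntPartition =>
    entryLaw p n {x | HasType (symMatrix x) lam}) (by rw [← h2]; exact ENNReal.one_ne_top)
  rw [← ENNReal.tsum_toReal_eq fun _ => measure_ne_top _ _, ← h2, ENNReal.toReal_one] at h3
  exact h3

end Recursion

/-! ### How the weight and the multiplicity product change when all parts are lowered. -/

section Weight

/-- `∑ (c + i) l_i` for a list `l₁, l₂, …`. -/
def shiftedWeight : ℕ → List ℕ → ℕ
  | _, [] => 0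
  | c, a :: l => (c + 1) * a + shiftedWeight (c + 1) l

theorem sum_get_eq_shiftedWeight (c : ℕ) (l : List ℕ) :
    ∑ i : Fin l.length, (c + (i : ℕ) + 1) * l.get i = shiftedWeight c l := by
  induction l generalizing c with
  | nil => rfl
  | cons a l ih =>
    rw [shiftedWeight, ← ih (c + 1)]
    simp only [List.length_cons]
    rw [Fin.sum_univ_succ]
    congr 1
    refine Finset.sum_congr rfl fun i _ => ?_
    simp only [Fin.val_succ, List.get_eq_getElem, List.getElem_cons_succ]
    ring

/-- Lowering every entry removes the sum of the coefficients `c + 1, …, c + length`; doubling avoids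
division. -/
theorem two_mul_shiftedWeight (c : ℕ) {l : List ℕ} (hl : ∀ a ∈ l, 0 < a) :
    2 * shiftedWeight c l =
      2 * shiftedWeight c (l.map (· - 1)) + l.length * (l.length + 1 + 2 * c) := by
  induction l generalizing c with
  | nil => simp
  | cons a l ih =>
    have h := ih (c + 1) fun b hb => hl b (List.mem_cons_of_mem _ hb)
    obtain ⟨b, rfl⟩ : ∃ b, a = b + 1 :=
      Nat.exists_eq_add_of_le' (hl a List.mem_cons_self)
    simp only [shiftedWeight, List.map_cons, List.length_cons, Nat.add_sub_cancel, mul_add 2]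
    rw [h]
    ring

/-- In a non-increasing list the zeros come last, so deleting them moves no positive entry. -/
theorem shiftedWeight_filter_pos (c : ℕ) {l : List ℕ} (hl : l.Pairwise (· ≥ ·)) :
    shiftedWeight c (l.filter fun a => 0 < a) = shiftedWeight c l := by
  induction l generalizing c with
  | nil => rfl
  | cons a l ih =>
    rw [List.pairwise_cons] at hl
    rcases Nat.eq_zero_or_pos a with rfl | ha
    · have h0 : l.filter (fun a => 0 < a) = [] := by
        rw [List.filter_eq_nil_iff]
        intro b hb
        have := hl.1 b hb
        simp
        omega
      have := ih (c + 1) hl.2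
      rw [h0] at this
      rw [List.filter_cons_of_neg (by simp), h0, shiftedWeight, shiftedWeight, ← this,
        shiftedWeight, mul_zero]
    · rw [List.filter_cons_of_pos (by simpa using ha), shiftedWeight, shiftedWeight, ih _ hl.2]

/-- `∑ i s_i`, where `s₁ ≥ s₂ ≥ ⋯` are the elements of `s`. -/
def weight (s : Multiset ℕ) : ℕ := shiftedWeight 0 (s.sort (· ≥ ·))

theorem weightedSum_eq (lam : IntPartition) : weightedSum lam = weight lam.2.parts := by
  rw [weight, ← sum_get_eq_shiftedWeight]
  simp only [Nat.zero_add]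
  rfl

theorem sort_predParts (s : Multiset ℕ) :
    (predParts s).sort (· ≥ ·) =
      ((s.sort (· ≥ ·)).map (· - 1)).filter fun a => 0 < a := by
  refine List.Perm.eq_of_pairwise' (r := (· ≥ ·)) (Multiset.pairwise_sort _ _) ?_ ?_
  · refine List.Pairwise.filter _ ?_
    rw [List.pairwise_map]
    exact (Multiset.pairwise_sort s (· ≥ ·)).imp fun h => Nat.sub_le_sub_right h 1
  · rw [← Multiset.coe_eq_coe, Multiset.sort_eq, ← Multiset.filter_coe, ← Multiset.map_coe,
      Multiset.sort_eq, predParts]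

theorem weight_eq {s : Multiset ℕ} (hs : ∀ a ∈ s, 0 < a) :
    weight s = weight (predParts s) + s.card * (s.card + 1) / 2 := by
  have h := two_mul_shiftedWeight 0 (l := s.sort (· ≥ ·)) fun a ha =>
    hs a ((Multiset.mem_sort _).1 ha)
  rw [Multiset.length_sort] at h
  rw [weight, weight, sort_predParts, shiftedWeight_filter_pos]
  · rw [mul_zero, add_zero] at h
    omega
  · rw [List.pairwise_map]
    exact (Multiset.pairwise_sort s (· ≥ ·)).imp fun h => Nat.sub_le_sub_right h 1

theorem count_predParts (s : Multiset ℕ) {i : ℕ} (hi : 0 < i) :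
    (predParts s).count i = s.count (i + 1) := by
  rw [predParts, Multiset.count_filter_of_pos hi]
  induction s using Multiset.induction_on with
  | empty => simp
  | cons a s ih =>
    rw [Multiset.map_cons, Multiset.count_cons, Multiset.count_cons, ih]
    congr 1
    by_cases h : i = a - 1
    · rw [if_pos h, if_pos (by omega)]
    · rw [if_neg h, if_neg (by omega)]

theorem card_predParts_add_count {s : Multiset ℕ} (hs : ∀ a ∈ s, 0 < a) :
    (predParts s).card + s.count 1 = s.card := by
  rw [predParts]
  induction s using Multiset.induction_on with
  | empty => simp
  | cons a s ih =>
    have h := ih fun b hb => hs b (Multiset.mem_cons_of_mem hb)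
    have ha := hs a (Multiset.mem_cons_self _ _)
    rw [Multiset.map_cons, Multiset.card_cons, Multiset.count_cons]
    by_cases h1 : a = 1
    · subst h1
      rw [Multiset.filter_cons_of_neg _ (by simp), if_pos rfl]
      omega
    · rw [Multiset.filter_cons_of_pos _ (by omega), if_neg (Ne.symm h1), Multiset.card_cons]
      omega

/-- `∏_i ∏_{j = 1}^{⌊m_i / 2⌋} (1 - t ^ (2 j))`, where `m_i` is the multiplicity of `i` in `s`. -/
noncomputable def multPoch (s : Multiset ℕ) (t : ℝ) : ℝ :=
  ∏ i ∈ s.toFinset, evenPoch t (s.count i / 2)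

theorem dPoly_eq (lam : IntPartition) (t : ℝ) : dPoly lam t = multPoch lam.2.parts t := by
  refine Finset.prod_congr rfl fun i _ => ?_
  rw [evenPoch, Finset.range_eq_Ico,
    Finset.prod_Ico_add' (fun j => 1 - t ^ (2 * j)) 0 (lam.2.parts.count i / 2) 1]
  rfl

theorem multPoch_pos {t : ℝ} (h0 : 0 ≤ t) (h1 : t < 1) (s : Multiset ℕ) : 0 < multPoch s t :=
  Finset.prod_pos fun _ _ => evenPoch_pos h0 h1 _

theorem multPoch_eq_prod_range {s : Multiset ℕ} {N : ℕ} (hN : ∀ a ∈ s, a < N) (t : ℝ) :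
    multPoch s t = ∏ i ∈ Finset.range N, evenPoch t (s.count i / 2) := by
  refine Finset.prod_subset (fun a ha => Finset.mem_range.2 (hN a (Multiset.mem_toFinset.1 ha)))
    fun a _ ha => ?_
  rw [Multiset.count_eq_zero.2 fun h => ha (Multiset.mem_toFinset.2 h)]
  rfl

/-- Multiplicities shift down by one index; only the multiplicity of the part `1` is lost. -/
theorem multPoch_predParts {s : Multiset ℕ} (hs : ∀ a ∈ s, 0 < a) (t : ℝ) :
    multPoch s t = multPoch (predParts s) t * evenPoch t (s.count 1 / 2) := by
  have hN : ∀ a ∈ s, a < s.sum + 2 := fun a ha =>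
    (Multiset.le_sum_of_mem ha).trans_lt (by omega)
  have hN' : ∀ a ∈ predParts s, a < s.sum + 1 := fun a ha => by
    obtain ⟨b, hb, rfl⟩ := Multiset.mem_map.1 (Multiset.mem_filter.1 ha).1
    have := Multiset.le_sum_of_mem hb
    omega
  have h0 : s.count 0 = 0 := Multiset.count_eq_zero.2 fun h => (hs 0 h).false
  have h0' : (predParts s).count 0 = 0 :=
    Multiset.count_eq_zero.2 fun h => (Multiset.mem_filter.1 h).2.false
  rw [multPoch_eq_prod_range hN, multPoch_eq_prod_range hN', Finset.prod_range_succ',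
    Finset.prod_range_succ', Finset.prod_range_succ', h0, h0']
  simp only [Nat.zero_div, Nat.zero_add]
  rw [show evenPoch t 0 = 1 from rfl, mul_one, mul_one]
  congr 1
  exact Finset.prod_congr rfl fun i _ => by rw [count_predParts s (Nat.succ_pos i)]

end Weight

/-! ### The exact formula for finite size, and uniform bounds on the products. -/

section Formula

variable {p : ℕ} [Fact p.Prime]

/-- In the recursion `qPoch t s.card` cancels. The inner `evenPoch` has index half of `s.card -
(predParts s).card`, the multiplicity of `1`, and so supplies the factor missing from `multPoch
(predParts s)`. -/
theorem entryLaw_hasParts_eq {n : ℕ} {s : Multiset ℕ} (hs : ∀ a ∈ s, 0 < a) (hn : s.card ≤ n) :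
    (entryLaw p n).real {x | HasParts (symMatrix x) s} =
      qPoch (p : ℝ)⁻¹ n / evenPoch (p : ℝ)⁻¹ ((n - s.card) / 2) *
        ((p : ℝ)⁻¹ ^ weight s / multPoch s (p : ℝ)⁻¹) := by
  obtain ⟨N, hN⟩ : ∃ N, N = s.sum := ⟨_, rfl⟩
  induction N using Nat.strong_induction_on generalizing n s with
  | _ N ih =>
    have hP := corankProb_eq (F := ZMod p) (n - s.card) s.card
    rw [Nat.add_sub_cancel' hn, ZMod.card] at hP
    rw [entryLaw_hasParts hs, hP]
    have hp : 1 < (p : ℝ) := by exact_mod_cast (Fact.out : p.Prime).one_lt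
    have h0 : 0 ≤ (p : ℝ)⁻¹ := by positivity
    have h1 : (p : ℝ)⁻¹ < 1 := inv_lt_one_of_one_lt₀ hp
    generalize ht : (p : ℝ)⁻¹ = t at *
    rcases Nat.eq_zero_or_pos s.card with hc | hc
    · obtain rfl := Multiset.card_eq_zero.1 hc
      have : {x : UpperIdx (0 : Multiset ℕ).card → ℤ_[p] | HasParts (symMatrix x) (predParts 0)} =
          Set.univ := by
        exact Set.eq_univ_of_forall hasParts_zero
      rw [this, probReal_univ]
      simp [qPoch, weight, multPoch, shiftedWeight]
    · have hsum := sum_predParts_add_card hs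
      have hcount := card_predParts_add_count hs
      rw [ih _ (by omega) (s := predParts s) (fun a ha => (Multiset.mem_filter.1 ha).2) (by omega) rfl,
        weight_eq hs, multPoch_predParts hs, pow_add,
        show s.card - (predParts s).card = s.count 1 by omega]
      have := (qPoch_pos h0 h1 s.card).ne'
      field_simp

theorem fn_eq {n : ℕ} {lam : IntPartition} (hn : lam.2.parts.card ≤ n) :
    fn p n lam = qPoch (p : ℝ)⁻¹ n / evenPoch (p : ℝ)⁻¹ ((n - lam.2.parts.card) / 2) *
      ((p : ℝ)⁻¹ ^ weightedSum lam / dPoly lam (p : ℝ)⁻¹) := by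
  rw [weightedSum_eq, dPoly_eq, ← entryLaw_hasParts_eq (fun _ h => lam.2.parts_pos h) hn, fn]
  simp only [hasType_iff]

theorem fn_eq_zero {n : ℕ} {lam : IntPartition} (hn : n < lam.2.parts.card) : fn p n lam = 0 := by
  rw [fn]
  convert measureReal_empty
  rw [Set.eq_empty_iff_forall_notMem]
  intro x hx
  have := ((hasType_iff _ _).1 hx).card_le
  rw [Fintype.card_fin] at this
  omega

/-- The bound is strengthened to `(1 + t ^ n) / 2` so that induction closes: a product at most one
loses at most `t ^ (n + 1)`, and `3t ≤ 1` makes this affordable. -/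
theorem half_le_prod_one_sub {t : ℝ} (h0 : 0 ≤ t) (h3 : 3 * t ≤ 1) {u : ℕ → ℝ}
    (hu : ∀ i, u i ≤ t ^ (i + 1)) (hu0 : ∀ i, 0 ≤ u i) (n : ℕ) :
    1 / 2 ≤ ∏ i ∈ Finset.range n, (1 - u i) := by
  have key : (1 + t ^ n) / 2 ≤ ∏ i ∈ Finset.range n, (1 - u i) ∧
      ∏ i ∈ Finset.range n, (1 - u i) ≤ 1 := by
    induction n with
    | zero => norm_num
    | succ n ih =>
      rw [Finset.prod_range_succ]
      have hn : 0 ≤ t ^ n := by positivity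
      have h1 := hu n
      have h2 := hu0 n
      rw [pow_succ] at h1 ⊢
      constructor
      · nlinarith [ih.1, ih.2, mul_le_mul_of_nonneg_left h3 hn, mul_nonneg h2 (sub_nonneg.2 ih.2)]
      · nlinarith [ih.1, ih.2, mul_nonneg h2 (by linarith [ih.1] :
          (0 : ℝ) ≤ ∏ i ∈ Finset.range n, (1 - u i))]
  have : 0 ≤ t ^ n := by positivity
  linarith [key.1]

theorem half_le_qPoch {t : ℝ} (h0 : 0 ≤ t) (h3 : 3 * t ≤ 1) (n : ℕ) : 1 / 2 ≤ qPoch t n :=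
  half_le_prod_one_sub h0 h3 (fun _ => le_rfl) (fun _ => by positivity) n

theorem half_le_evenPoch {t : ℝ} (h0 : 0 ≤ t) (h3 : 3 * t ≤ 1) (n : ℕ) : 1 / 2 ≤ evenPoch t n :=
  half_le_prod_one_sub h0 h3
    (fun _ => pow_le_pow_of_le_one h0 (by linarith) (by omega)) (fun _ => by positivity) n

theorem qPoch_le_one {t : ℝ} (h0 : 0 ≤ t) (h1 : t < 1) (n : ℕ) : qPoch t n ≤ 1 :=
  Finset.prod_le_one (fun i _ => sub_nonneg.2 (pow_le_one₀ h0 h1.le))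
    fun i _ => sub_le_self _ (by positivity)

theorem tendsto_qPoch : Tendsto (qPoch (p : ℝ)⁻¹) atTop (𝓝 (piInf p)) := by
  have hp : 1 < (p : ℝ) := by exact_mod_cast (Fact.out : p.Prime).one_lt
  exact (multipliable_one_sub_pow (t := (p : ℝ)⁻¹) (by positivity)
    (inv_lt_one_of_one_lt₀ hp)).1.hasProd.tendsto_prod_nat

theorem tendsto_evenPoch : Tendsto (evenPoch (p : ℝ)⁻¹) atTop (𝓝 (betaInf p)) := by
  have hp : 1 < (p : ℝ) := by exact_mod_cast (Fact.out : p.Prime).one_lt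
  exact (multipliable_one_sub_pow (t := (p : ℝ)⁻¹) (by positivity)
    (inv_lt_one_of_one_lt₀ hp)).2.hasProd.tendsto_prod_nat

end Formula

end SymPadic

/-! ### Passage to the limit. -/

theorem mainTheorem6 (p : ℕ) [Fact p.Prime] (hp : p ≠ 2) :
    (∀ lam : SymPadic.IntPartition,
      Tendsto (fun n : ℕ => SymPadic.fn p n lam) atTop (𝓝 (SymPadic.fLim p lam))) ∧
    (∀ lam : SymPadic.IntPartition, 0 ≤ SymPadic.fLim p lam) ∧
    HasSum (fun lam : SymPadic.IntPartition => SymPadic.fLim p lam) 1 := by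
  open SymPadic in
  -- Oddness enters only here, to give `3 / p ≤ 1` for the uniform bounds.
  have hp3 : (3 : ℝ) ≤ p := by
    have := (Fact.out : p.Prime).two_le
    exact_mod_cast (by omega : 3 ≤ p)
  have h0 : 0 ≤ (p : ℝ)⁻¹ := by positivity
  have h3 : 3 * (p : ℝ)⁻¹ ≤ 1 := by
    rw [mul_inv_le_iff₀ (by linarith)]
    linarith
  have h1 : (p : ℝ)⁻¹ < 1 := by linarith
  have hpi : 1 / 2 ≤ piInf p := ge_of_tendsto' tendsto_qPoch (half_le_qPoch h0 h3)
  have hbeta : 1 / 2 ≤ betaInf p := ge_of_tendsto' tendsto_evenPoch (half_le_evenPoch h0 h3)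
  have hd : ∀ lam, 0 < dPoly lam (p : ℝ)⁻¹ := fun lam => by
    rw [dPoly_eq]; exact multPoch_pos h0 h1 _
  let g : IntPartition → ℝ := fun lam => (p : ℝ)⁻¹ ^ weightedSum lam / dPoly lam (p : ℝ)⁻¹
  have hg : ∀ lam, 0 ≤ g lam := fun lam => div_nonneg (by positivity) (hd lam).le
  have hf : ∀ lam, fLim p lam = piInf p / betaInf p * g lam := fun lam => by
    rw [fLim, div_mul_eq_div_div]
    ring
  have hlim : ∀ lam, Tendsto (fun n : ℕ => fn p n lam) atTop (𝓝 (fLim p lam)) := fun lam => by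
    have hk : Tendsto (fun n : ℕ => (n - lam.2.parts.card) / 2) atTop atTop :=
      (Nat.tendsto_div_const_atTop two_ne_zero).comp (tendsto_sub_atTop_nat _)
    rw [hf]
    refine ((tendsto_qPoch.div (tendsto_evenPoch.comp hk) (by linarith)).mul_const (g lam)).congr' ?_
    filter_upwards [eventually_ge_atTop lam.2.parts.card] with n hn
    exact (fn_eq hn).symm
  have hnonneg : ∀ lam, 0 ≤ fLim p lam := fun lam => by
    rw [hf]
    exact mul_nonneg (div_nonneg (by linarith) (by linarith)) (hg lam)
  -- As in Fatou's lemma: finite partial sums are limits of partial sums of `fn`, which are at most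
  -- one.
  have hsummable : Summable fun lam => fLim p lam := by
    refine summable_of_sum_le (c := 1) hnonneg fun u => ?_
    refine le_of_tendsto' (tendsto_finsetSum u fun lam _ => hlim lam) fun n => ?_
    exact sum_le_hasSum u (fun _ _ => measureReal_nonneg) (hasSum_fn n)
  -- Since `qPoch ≤ 1` and `evenPoch ≥ 1/2`, `fn` is at most `2 g`, and `2 ≤ 4 * piInf p`; the
  -- factor `betaInf p` clears the denominator of `fLim`.
  have hbound : ∀ n lam, ‖fn p n lam‖ ≤ 4 * fLim p lam * betaInf p := by
    intro n lam
    have hnn : 0 ≤ fn p n lam := measureReal_nonneg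
    rw [hf, Real.norm_of_nonneg hnn]
    have hr : 4 * (piInf p / betaInf p * g lam) * betaInf p = 4 * piInf p * g lam := by
      have : betaInf p ≠ 0 := by linarith
      field_simp
    rw [hr]
    rcases lt_or_ge n lam.2.parts.card with hn | hn
    · rw [fn_eq_zero hn]
      exact mul_nonneg (by linarith) (hg lam)
    · rw [fn_eq hn]
      refine mul_le_mul_of_nonneg_right ?_ (hg lam)
      have he := half_le_evenPoch h0 h3 ((n - lam.2.parts.card) / 2)
      rw [div_le_iff₀ (by linarith)]
      have := qPoch_le_one h0 h1 n
      nlinarith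
  have htsum := tendsto_tsum_of_dominated_convergence (𝓕 := atTop)
    ((hsummable.mul_left 4).mul_right (betaInf p)) hlim (Eventually.of_forall hbound)
  simp only [(hasSum_fn (p := p) _).tsum_eq] at htsum
  refine ⟨hlim, hnonneg, ?_⟩
  rw [tendsto_nhds_unique tendsto_const_nhds htsum]
  exact hsummable.hasSum
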